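/- \textbf{Setting.} Let $L,c,N\ge 1$ and widths $d_0,\dots,d_L$ be integers, and let $\mathbf M\in\mathbb R^{c\times c}$ be orthogonal. For $T\in\mathbb R^{m\times n\times c}$ put $M(T)=T\times_3\mathbf M$; the t-product is $A*_MB=M^{-1}(M(A)\odot M(B))$, where $\odot$ multiplies corresponding frontal slices. The t-transpose $T^\top$ and the t-identity are the tensors whose frontal slices in the transformed domain are the transposes of those of $M(T)$, resp. identity matrices; $Q$ is t-orthogonal if $Q^\top*_MQ=Q*_MQ^\top$ is the t-identity. A t-SVD of $T$ is a factorization $T=U*_MS*_MV^\top$ with $U,V$ t-orthogonal and all frontal slices of $S$ diagonal. The tubal rank $r_t(T)$ is the number of non-zero tubes $S(i,i,:)$, $i\le\min\{m,n\}$, in a t-SVD (the smallest such number over all t-SVDs, which is attained when the singular values of each slice of $M(T)$ are listed in non-increasing order). For weights $W^{(l)}\in\mathbb R^{d_l\times d_{l-1}\times c}$ $(1\le l\le L)$ and $w\in\mathbb R^{cd_L}$, the t-NN is $f(x)=w^\top\mathrm{vec}(f^{(L)}(x))$, where $f^{(0)}(x)=x\in\mathbb R^{d_0\times1\times c}$,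 $f^{(l)}(x)=\sigma(W^{(l)}*_Mf^{(l-1)}(x))$ and $\sigma(u)=\max\{u,0\}$ entrywise. Let $B_w,B_1,\dots,B_L>0$. Let $\mathfrak F$ be the class of all t-NNs with $\|w\|_2\le B_w$ and $\|W^{(l)}\|_F\le B_l$ for all $l$. For integers $0\le r_l\le\min\{d_l,d_{l-1}\}$, let $\mathfrak F_{\mathbf r}\subseteq\mathfrak F$ be the class of those t-NNs whose weights satisfy in addition $r_t(W^{(l)})\le r_l$ for all $l$. \emph{Data.} $(x_i,y_i)_{i=1}^N$ are i.i.d. from a probability distribution $P$ on $\mathbb R^{d_0\times1\times c}\times\{\pm1\}$ with $\|x\|_F\le B_x$ almost surely, where $B_x>0$. \emph{Attack.} $R_a$ is a norm on $\mathbb R^{d_0\times1\times c}$, $\xi\ge0$, and $C_{R_a}=\sup_{x\ne0}\|x\|_F/R_a(x)$. Put $B_{\tilde f}=(B_x+\xi C_{R_a})\,B_w\prod_{l=1}^LB_l$. \emph{Loss.} $\ell(f(x),y)=\exp(-\mathfrak f(yf(x)))$, where $B>0$ and (A.1) $\ell(f(x'),y)\in[0,B]$ for all $f\in\mathfrak F$,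 all $y\in\{\pm1\}$ and all $x'$ with $R_a(x'-x)\le\xi$ for some $x$ with $\|x\|_F\le B_x$; (A.2) $\mathfrak f:\mathbb R\to\mathbb R$ is $C^1$; (A.3) $\mathfrak f'\ge0$; (A.4) for some $b\ge0$, $u\mathfrak f'(u)$ is non-decreasing on $(b,\infty)$ and $u\mathfrak f'(u)\to+\infty$ as $u\to+\infty$; (A.5) $\mathfrak f:[b,\infty)\to[\mathfrak f(b),\infty)$ has an inverse $\mathfrak g$, and there are $b_{\mathfrak g}\ge\max\{2\mathfrak f(b),\mathfrak f(2b)\}$ and $K\ge1$ with $\mathfrak g'(u)\le K\mathfrak g'(\theta u)$ and $\mathfrak f'(v)\le K\mathfrak f'(\theta v)$ for all $u>b_{\mathfrak g}$, $v>\mathfrak g(b_{\mathfrak g})$, $\theta\in[1/2,1)$. Put $L_\ell=\sup_{|q|\le B_{\tilde f}}\mathfrak f'(q)e^{-\mathfrak f(q)}$. \emph{Risks.} With $\tilde\ell(f(x),y)=\max_{R_a(x'-x)\le\xi}\ell(f(x'),y)$, let $\mathcal L^{\mathrm{adv}}(f)=\mathbb E_P[\tilde\ell(f(x),y)]$ and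 $\hat{\mathcal L}^{\mathrm{adv}}(f)=\frac1N\sum_{i=1}^N\tilde\ell(f(x_i),y_i)$. \textbf{Theorem (adversarial generalization bound with transformed low-rank weights).} There is an absolute constant $C'>0$ such that in every such setting and for every $t>0$, with probability at least $1-2e^{-t}$ over the sample, simultaneously for all $f\in\mathfrak F_{\mathbf r}$, $$\mathcal L^{\mathrm{adv}}(f)-\hat{\mathcal L}^{\mathrm{adv}}(f)\le\frac{C'L_\ell B_{\tilde f}}{\sqrt N}\sqrt{c\sum_{l=1}^Lr_l(d_{l-1}+d_l)\log(9(L+1))}+3B\sqrt{\frac t{2N}}.$$ -/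

import Mathlib

open MeasureTheory Filter Set

noncomputable section

/-- Real tensors of size `m × n × c`. The norm `‖T‖` is the Frobenius norm. -/
abbrev Tensor3 (m n c : ℕ) : Type := EuclideanSpace ℝ (Fin m × Fin n × Fin c)

/-- t-vectors with `d` features in each of `c` channels: tensors of size `d × 1 × c`. -/
abbrev TVec (d c : ℕ) : Type := Tensor3 d 1 c

namespace Tensor3

variable {m n k c : ℕ}

/-- The `s`-th frontal slice `T(:,:,s)`. -/
def slice (T : Tensor3 m n c) (s : Fin c) : Matrix (Fin m) (Fin n) ℝ :=
  Matrix.of fun i j => T (i, j, s)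

/-- The tensor with prescribed frontal slices. -/
def ofSlices (A : Fin c → Matrix (Fin m) (Fin n) ℝ) : Tensor3 m n c :=
  WithLp.toLp 2 fun p => A p.2.2 p.1 p.2.1

/-- The tensor-matrix product on mode 3, `T ×₃ A`. -/
def mode3 (T : Tensor3 m n c) (A : Matrix (Fin c) (Fin c) ℝ) : Tensor3 m n c :=
  WithLp.toLp 2 fun p => ∑ s, A p.2.2 s * T (p.1, p.2.1, s)

/-- The t-product `A *_M B = M⁻¹(M(A) ⊙ M(B))`, where `⊙` multiplies frontal slices. -/
def tProd (M : Matrix (Fin c) (Fin c) ℝ) (A : Tensor3 m n c) (B : Tensor3 n k c) :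
    Tensor3 m k c :=
  mode3 (ofSlices fun s => slice (mode3 A M) s * slice (mode3 B M) s) M⁻¹

/-- The t-transpose: the frontal slices are transposed in the transformed domain. -/
def tTranspose (M : Matrix (Fin c) (Fin c) ℝ) (T : Tensor3 m n c) : Tensor3 n m c :=
  mode3 (ofSlices fun s => (slice (mode3 T M) s).transpose) M⁻¹

/-- The t-identity: all frontal slices are the identity in the transformed domain. -/
def tOne (M : Matrix (Fin c) (Fin c) ℝ) : Tensor3 m m c :=
  mode3 (ofSlices fun _ => 1) M⁻¹

/-- t-orthogonal tensors. -/
def IsTOrthogonal (M : Matrix (Fin c) (Fin c) ℝ) (Q : Tensor3 m m c) : Prop :=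
  tProd M (tTranspose M Q) Q = tOne M ∧ tProd M Q (tTranspose M Q) = tOne M

/-- f-diagonal tensors: all frontal slices are diagonal. -/
def IsFDiagonal (S : Tensor3 m n c) : Prop :=
  ∀ (i : Fin m) (j : Fin n) (s : Fin c), (i : ℕ) ≠ (j : ℕ) → S (i, j, s) = 0

/-- `T = U *_M S *_M Vᵀ` is a t-SVD of `T`. -/
def IsTSVD (M : Matrix (Fin c) (Fin c) ℝ) (T : Tensor3 m n c)
    (U : Tensor3 m m c) (S : Tensor3 m n c) (V : Tensor3 n n c) : Prop :=
  IsTOrthogonal M U ∧ IsTOrthogonal M V ∧ IsFDiagonal S ∧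
    T = tProd M (tProd M U S) (tTranspose M V)

/-- The number of non-zero tubes `S(i,i,:)`, `i < min m n`. -/
def numTubes (S : Tensor3 m n c) : ℕ∞ :=
  Set.encard {i : Fin (min m n) | ∃ s : Fin c,
    S (Fin.castLE (min_le_left m n) i, Fin.castLE (min_le_right m n) i, s) ≠ 0}

/-- The tubal rank: the number of non-zero tubes of `S` in a t-SVD. This number depends on the
order in which the singular values are listed in the individual transformed slices; the minimum
over all t-SVDs is the number obtained from the usual (non-increasing) order. A t-SVD always
exists, so the value is finite. -/
def tubalRank (M : Matrix (Fin c) (Fin c) ℝ) (T : Tensor3 m n c) : ℕ∞ :=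
  ⨅ (U : Tensor3 m m c) (S : Tensor3 m n c) (V : Tensor3 n n c) (_ : IsTSVD M T U S V),
    numTubes S

/-- Entrywise ReLU. -/
def relu (T : Tensor3 m n c) : Tensor3 m n c := WithLp.toLp 2 fun p => max (T p) 0

end Tensor3

/-- The weights of a t-NN with `L` t-product layers: layer `l + 1` has a weight tensor of size
`d (l+1) × d l × c`. The weight of the final linear functional is indexed by the entries of the
last feature t-vector, that is, `vec` is left implicit. -/
structure TNNWeights (L c : ℕ) (d : ℕ → ℕ) where
  layer : ∀ l : Fin L, Tensor3 (d (l + 1)) (d l) c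
  out : TVec (d L) c

namespace TNNWeights

variable {L c : ℕ} {d : ℕ → ℕ}

/-- The output of the first `l` layers. -/
def feature (M : Matrix (Fin c) (Fin c) ℝ) (θ : TNNWeights L c d) (x : TVec (d 0) c) :
    ∀ l : ℕ, l ≤ L → TVec (d l) c
  | 0, _ => x
  | l + 1, h =>
    Tensor3.relu (Tensor3.tProd M (θ.layer ⟨l, h⟩) (feature M θ x l (Nat.le_of_succ_le h)))

/-- The t-NN predictor `f(x; θ) = wᵀ vec(f^{(L)}(x))`. -/
def predict (M : Matrix (Fin c) (Fin c) ℝ) (θ : TNNWeights L c d) (x : TVec (d 0) c) : ℝ :=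
  ∑ p, θ.out p * θ.feature M x L le_rfl p

end TNNWeights

/-- The class of t-NNs whose weights satisfy `‖w‖ ≤ Bw` and `‖W^{(l)}‖_F ≤ Bl l`.
The index `l : Fin L` stands for layer `l + 1`. -/
def tnnClass {L c : ℕ} (d : ℕ → ℕ) (M : Matrix (Fin c) (Fin c) ℝ) (Bw : ℝ) (Bl : Fin L → ℝ) :
    Set (TVec (d 0) c → ℝ) :=
  {f | ∃ θ : TNNWeights L c d, ‖θ.out‖ ≤ Bw ∧ (∀ l, ‖θ.layer l‖ ≤ Bl l) ∧ f = θ.predict M}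

/-- The t-NNs in `tnnClass` whose weight tensors have tubal rank at most `r l`. -/
def lowRankClass {L c : ℕ} (d : ℕ → ℕ) (M : Matrix (Fin c) (Fin c) ℝ) (Bw : ℝ)
    (Bl : Fin L → ℝ) (r : Fin L → ℕ) : Set (TVec (d 0) c → ℝ) :=
  {f | ∃ θ : TNNWeights L c d, ‖θ.out‖ ≤ Bw ∧ (∀ l, ‖θ.layer l‖ ≤ Bl l) ∧
    (∀ l, Tensor3.tubalRank M (θ.layer l) ≤ (r l : ℕ∞)) ∧ f = θ.predict M}

/-- The compatibility constant of the norm `R`: the least `C` with `‖x‖_F ≤ C * R x`. -/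
def compatConst {d c : ℕ} (R : Seminorm ℝ (TVec d c)) : ℝ :=
  sSup ((fun x => ‖x‖ / R x) '' {x | x ≠ 0})

/-- The bound `(Bx + ξ C) * Bw * ∏ Bl` on the output of the t-NNs under attack. -/
def outBound {L d c : ℕ} (R : Seminorm ℝ (TVec d c)) (ξ Bx Bw : ℝ) (Bl : Fin L → ℝ) : ℝ :=
  (Bx + ξ * compatConst R) * (Bw * ∏ l, Bl l)

/-- The loss `ℓ(q, y) = exp(-φ(y q))`. -/
def expLoss (φ : ℝ → ℝ) (q y : ℝ) : ℝ := Real.exp (-φ (y * q))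

/-- The Lipschitz constant `sup_{|q| ≤ b} φ'(q) exp(-φ(q))` of the loss. -/
def lossLip (φ : ℝ → ℝ) (b : ℝ) : ℝ :=
  sSup ((fun q => deriv φ q * Real.exp (-φ q)) '' Icc (-b) b)

/-- Smoothness, monotonicity and growth of the function `φ` in the loss. -/
structure RegularExponent (φ : ℝ → ℝ) : Prop where
  contDiff : ContDiff ℝ 1 φ
  deriv_nonneg : ∀ x, 0 ≤ deriv φ x
  /-- `g` is the inverse of `φ : [b, ∞) → [φ b, ∞)`; only its values on `[φ b, ∞)` matter. -/
  growth : ∃ b : ℝ, 0 ≤ b ∧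
    MonotoneOn (fun x => x * deriv φ x) (Ioi b) ∧
    Tendsto (fun x => x * deriv φ x) atTop atTop ∧
    ∃ g : ℝ → ℝ, (∀ x, b ≤ x → g (φ x) = x) ∧ (∀ u, φ b ≤ u → b ≤ g u ∧ φ (g u) = u) ∧
      ∃ bg K : ℝ, max (2 * φ b) (φ (2 * b)) ≤ bg ∧ 1 ≤ K ∧
        (∀ x, bg < x → ∀ s ∈ Ico (1 / 2 : ℝ) 1, deriv g x ≤ K * deriv g (s * x)) ∧
        (∀ y, g bg < y → ∀ s ∈ Ico (1 / 2 : ℝ) 1, deriv φ y ≤ K * deriv φ (s * y))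

/-- The adversarial loss `max_{R(x' - x) ≤ ξ} ℓ(f(x'), y)`. -/
def advLoss {d c : ℕ} (φ : ℝ → ℝ) (R : Seminorm ℝ (TVec d c)) (ξ : ℝ) (f : TVec d c → ℝ)
    (z : TVec d c × ℝ) : ℝ :=
  sSup ((fun x' => expLoss φ (f x') z.2) '' {x' | R (x' - z.1) ≤ ξ})

/-- The population adversarial risk. -/
def advRisk {d c : ℕ} (φ : ℝ → ℝ) (R : Seminorm ℝ (TVec d c)) (ξ : ℝ)
    (P : Measure (TVec d c × ℝ)) (f : TVec d c → ℝ) : ℝ :=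
  ∫ z, advLoss φ R ξ f z ∂P

/-- The empirical adversarial risk on the sample `S`. -/
def empAdvRisk {d c N : ℕ} (φ : ℝ → ℝ) (R : Seminorm ℝ (TVec d c)) (ξ : ℝ)
    (S : Fin N → TVec d c × ℝ) (f : TVec d c → ℝ) : ℝ :=
  (N : ℝ)⁻¹ * ∑ i, advLoss φ R ξ f (S i)

end

/-!
The deviation `X f = advRisk f - empAdvRisk f` is itself a centred process with sub-Gaussian
increments: by Hoeffding's lemma, `X f - X g` has variance proxy `δ ^ 2 / N` as soon as the
adversarial losses of `f` and `g` differ by at most `δ`. So it can be chained directly, without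
symmetrization or Rademacher complexities.

The class is parametrized by the unit ball of a normed space. If `W` has tubal rank at most `r`,
the columns of each transformed frontal slice span a space of dimension at most `r`, so the slice
factors as a contraction `P s` applied to coordinate columns `q (s, j)` of the same Euclidean length
(`Tensor3.exists_ofFactors_eq`). With the operator norm on the maps `P s` and the Euclidean norm on
all columns together, the unit ball of these factors is mapped in a `2 * Bl l`-Lipschitz way into
the weights of norm at most `Bl l`, and its image contains all those of tubal rank at most `r l`; no
constant depends on the ranks. The parameter space, with
the output weights, has dimension at most `2 * D` for `D = c * ∑ r l * (d l + d (l + 1))`, because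
`c * d L ≤ D` unless the last tubal rank is zero, in which case the class is `{0}`.

The orthogonal transform preserves Frobenius norms and ReLU is `1`-Lipschitz, so the output
of the network depends on the parameter with Lipschitz constant `(2 * L + 1) * outBound`
(`TNNWeights.abs_predict_sub_predict_le`) while being bounded by `outBound`. Composition with the
loss and the supremum over the attack contribute the factor `lossLip`
(`abs_expLoss_sub_le`, `abs_advLoss_sub_le`).

A volume argument (`exists_net_unitBall`) gives nets of the unit ball at the scales
`2 ^ (-k) / (2 * L + 1)` of log-cardinality at most `2 * D * log (9 * (L + 1)) * (k + 1)`, and the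
chaining sum over the links (`integral_sup'_meanDeviation_le_sum`) bounds the expected supremum over
any of these nets. The supremum over a finite net concentrates by the bounded differences
inequality (`measure_le_of_bounded_differences`). The version proved here has deviation
`2 * B * √(t / (2 * N))`, so one `B * √(t / (2 * N))` of the claimed bound is left to pass from a
sufficiently fine net to the whole class; only finite suprema are ever integrated.
-/

/-! ### Nets of the unit ball -/

theorem card_le_of_separated_unitBall {E : Type*} [NormedAddCommGroup E] [NormedSpace ℝ E]
    [FiniteDimensional ℝ E] {ε : ℝ} (hε : 0 < ε) (hε1 : ε ≤ 1) (s : Finset E)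
    (hs : ∀ x ∈ s, ‖x‖ ≤ 1) (hsep : ∀ x ∈ s, ∀ y ∈ s, x ≠ y → ε < ‖x - y‖) :
    (s.card : ℝ) ≤ (3 / ε) ^ Module.finrank ℝ E := by
  borelize E
  let μ : Measure E := Measure.addHaar
  have hδ : 0 < ε / 2 := by positivity
  have hρ : (0 : ℝ) < 3 / 2 := by norm_num
  have hdisj : Set.Pairwise (s : Set E)
      (Function.onFun Disjoint fun x => Metric.ball x (ε / 2)) := by
    intro x hx y hy hxy
    apply Metric.ball_disjoint_ball
    rw [dist_eq_norm]
    linarith [hsep x hx y hy hxy]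
  have hsub : (⋃ x ∈ s, Metric.ball x (ε / 2)) ⊆ Metric.ball (0 : E) (3 / 2) := by
    refine iUnion₂_subset fun x hx => Metric.ball_subset_ball' ?_
    rw [dist_zero_right]
    linarith [hs x hx]
  have hvol : (s.card : ENNReal) * ENNReal.ofReal ((ε / 2) ^ Module.finrank ℝ E) *
      μ (Metric.ball 0 1) ≤
      ENNReal.ofReal ((3 / 2) ^ Module.finrank ℝ E) * μ (Metric.ball 0 1) := by
    calc _ = μ (⋃ x ∈ s, Metric.ball x (ε / 2)) := by
          rw [measure_biUnion_finset hdisj fun x _ => measurableSet_ball]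
          simp only [μ.addHaar_ball_of_pos _ hδ, Finset.sum_const, nsmul_eq_mul, mul_assoc]
      _ ≤ μ (Metric.ball (0 : E) (3 / 2)) := measure_mono hsub
      _ = _ := μ.addHaar_ball_of_pos _ hρ
  have h1 := (ENNReal.mul_le_mul_iff_left (Metric.measure_ball_pos μ _ zero_lt_one).ne'
    measure_ball_lt_top.ne).1 hvol
  have h2 := ENNReal.toReal_le_of_le_ofReal (by positivity) h1
  rw [ENNReal.toReal_mul, ENNReal.toReal_natCast, ENNReal.toReal_ofReal (by positivity)] at h2
  rw [show 3 / ε = (3 / 2) / (ε / 2) by field_simp, div_pow, le_div_iff₀ (by positivity)]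
  exact h2

/-- The unit ball of an `n`-dimensional normed space has an `ε`-net of at most `(3 / ε) ^ n` of
its points: any maximal `ε`-separated subset is one. -/
theorem exists_net_unitBall {E : Type*} [NormedAddCommGroup E] [NormedSpace ℝ E]
    [FiniteDimensional ℝ E] {ε : ℝ} (hε : 0 < ε) (hε1 : ε ≤ 1) :
    ∃ s : Finset E, (∀ x ∈ s, ‖x‖ ≤ 1) ∧ (∀ x : E, ‖x‖ ≤ 1 → ∃ y ∈ s, ‖x - y‖ ≤ ε) ∧
      (s.card : ℝ) ≤ (3 / ε) ^ Module.finrank ℝ E := by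
  classical
  let Sep : Finset E → Prop := fun s =>
    (∀ x ∈ s, ‖x‖ ≤ 1) ∧ ∀ x ∈ s, ∀ y ∈ s, x ≠ y → ε < ‖x - y‖
  have hbd : BddAbove (Finset.card '' {s | Sep s}) := by
    refine ⟨⌊(3 / ε) ^ Module.finrank ℝ E⌋₊, ?_⟩
    rintro _ ⟨s, hs, rfl⟩
    exact Nat.le_floor (card_le_of_separated_unitBall hε hε1 s hs.1 hs.2)
  have hne : (Finset.card '' {s | Sep s}).Nonempty := ⟨_, ∅, by simp [Sep], rfl⟩
  obtain ⟨s, hs, hmax⟩ := Nat.sSup_mem hne hbd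
  refine ⟨s, hs.1, fun x hx => ?_, card_le_of_separated_unitBall hε hε1 s hs.1 hs.2⟩
  by_contra! hcon
  have hxs : x ∉ s := fun h => by
    have := hcon x h
    simp only [sub_self, norm_zero] at this
    linarith
  have hins : Sep (insert x s) := by
    refine ⟨fun y hy => ?_, fun y hy z hz hyz => ?_⟩
    · rcases Finset.mem_insert.1 hy with rfl | hy
      exacts [hx, hs.1 y hy]
    · rcases Finset.mem_insert.1 hy with hyx | hys <;> rcases Finset.mem_insert.1 hz with hzx | hzs
      · exact absurd (hyx.trans hzx.symm) hyz
      · exact hyx ▸ hcon z hzs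
      · rw [norm_sub_rev]
        exact hzx ▸ hcon y hys
      · exact hs.2 y hys z hzs hyz
  have hle : (insert x s).card ≤ s.card := hmax ▸ le_csSup hbd ⟨_, hins, rfl⟩
  rw [Finset.card_insert_of_notMem hxs] at hle
  omega

/-! ### Maximal inequality and bounded differences -/

theorem le_sqrt_two_mul_of_forall_le {x a v : ℝ} (ha : 0 ≤ a) (hv : 0 ≤ v)
    (h : ∀ s : ℝ, 0 < s → x ≤ a / s + s * v / 2) : x ≤ √(2 * a * v) := by
  rcases le_or_gt x 0 with hx | hx
  · exact hx.trans (Real.sqrt_nonneg _)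
  rcases hv.eq_or_lt with rfl | hv
  · have h1 := h ((a + 1) / x) (by positivity)
    have h2 : a / ((a + 1) / x) < x := by
      rw [div_div_eq_mul_div, div_lt_iff₀ (by positivity)]
      nlinarith
    linarith
  · refine Real.le_sqrt_of_sq_le ?_
    -- `s = x / v` balances the two terms
    have h1 := h (x / v) (by positivity)
    have h2 : x * x ≤ x * (a / (x / v) + x / v * v / 2) := mul_le_mul_of_nonneg_left h1 hx.le
    have h3 : x * (a / (x / v) + x / v * v / 2) = a * v + x * x / 2 := by
      field_simp
    nlinarith

theorem integrable_finset_sup' {Ω ι : Type*} [MeasurableSpace Ω] {μ : Measure Ω} (s : Finset ι)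
    (hs : s.Nonempty) {X : ι → Ω → ℝ} (hX : ∀ i ∈ s, Integrable (X i) μ) :
    Integrable (fun ω => s.sup' hs fun i => X i ω) μ := by
  classical
  induction hs using Finset.Nonempty.cons_induction with
  | singleton a => simpa using hX a (by simp)
  | cons a s ha hs ih =>
    have h1 := ih fun i hi => hX i (by simp [hi])
    have h2 := (hX a (by simp)).sup h1
    refine h2.congr (ae_of_all _ fun ω => ?_)
    exact (Finset.sup'_cons hs fun i => X i ω).symm

/-- Chernoff's method with the Young-type inequality `log y ≤ log a + y / a - 1` in place of
Jensen's inequality. -/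
theorem integral_sup'_le_of_hasSubgaussianMGF {Ω ι : Type*} [MeasurableSpace Ω] {μ : Measure Ω}
    [IsProbabilityMeasure μ] (s : Finset ι) (hs : s.Nonempty) {X : ι → Ω → ℝ} {v : NNReal}
    (hX : ∀ i ∈ s, ProbabilityTheory.HasSubgaussianMGF (X i) v μ) :
    ∫ ω, s.sup' hs (fun i => X i ω) ∂μ ≤ √(2 * Real.log s.card * v) := by
  have hcard : (1 : ℝ) ≤ s.card := by exact_mod_cast hs.card_pos
  refine le_sqrt_two_mul_of_forall_le (Real.log_nonneg hcard) v.2 fun r hr => ?_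
  set a : ℝ := s.card * Real.exp (v * r ^ 2 / 2) with ha
  have hapos : 0 < a := by positivity
  have hloga : Real.log a = Real.log s.card + v * r ^ 2 / 2 := by
    rw [ha, Real.log_mul (by positivity) (by positivity), Real.log_exp]
  have hpt : ∀ ω, s.sup' hs (fun i => X i ω) ≤
      r⁻¹ * ((∑ i ∈ s, Real.exp (r * X i ω)) / a + (Real.log a - 1)) := by
    intro ω
    refine Finset.sup'_le hs _ fun i hi => ?_
    have h1 : Real.exp (r * X i ω) ≤ ∑ j ∈ s, Real.exp (r * X j ω) :=
      Finset.single_le_sum (f := fun j => Real.exp (r * X j ω)) (fun j _ => (Real.exp_pos _).le) hi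
    have h2 : r * X i ω - Real.log a + 1 ≤ Real.exp (r * X i ω) / a := by
      have := Real.add_one_le_exp (r * X i ω - Real.log a)
      rwa [Real.exp_sub, Real.exp_log hapos] at this
    have h3 : Real.exp (r * X i ω) / a ≤ (∑ j ∈ s, Real.exp (r * X j ω)) / a := by gcongr
    rw [le_inv_mul_iff₀ hr]
    linarith
  have hint : ∀ i ∈ s, Integrable (fun ω => Real.exp (r * X i ω)) μ :=
    fun i hi => (hX i hi).integrable_exp_mul r
  have hint2 : Integrable (fun ω => (∑ i ∈ s, Real.exp (r * X i ω)) / a) μ :=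
    (integrable_finsetSum s hint).div_const a
  calc ∫ ω, s.sup' hs (fun i => X i ω) ∂μ
      ≤ ∫ ω, r⁻¹ * ((∑ i ∈ s, Real.exp (r * X i ω)) / a + (Real.log a - 1)) ∂μ :=
        integral_mono (integrable_finset_sup' s hs fun i hi => (hX i hi).integrable)
          ((hint2.add (integrable_const _)).const_mul _) hpt
    _ = r⁻¹ * ((∑ i ∈ s, ∫ ω, Real.exp (r * X i ω) ∂μ) / a + (Real.log a - 1)) := by
        rw [integral_const_mul, integral_add hint2 (integrable_const _), integral_div,
          integral_finsetSum s hint]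
        simp
    _ ≤ r⁻¹ * (1 + (Real.log a - 1)) := by
        have : (∑ i ∈ s, ∫ ω, Real.exp (r * X i ω) ∂μ) ≤ a := by
          rw [ha, ← nsmul_eq_mul]
          exact Finset.sum_le_card_nsmul _ _ _ fun i hi => (hX i hi).mgf_le r
        gcongr
        exact (div_le_one hapos).2 this
    _ = Real.log s.card / r + r * v / 2 := by
        rw [hloga]
        field_simp
        ring

/-- McDiarmid's bounded differences inequality at the level of the moment generating function, by
induction on the number of coordinates: conditionally on the others, the first coordinate is
handled by Hoeffding's lemma. The constant is four times the optimal one, since the conditional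
range is enclosed in an interval centred at an arbitrary value. -/
theorem integral_exp_mul_sub_integral_le_of_bounded_differences {Ω : Type*} [MeasurableSpace Ω]
    (P : Measure Ω) [IsProbabilityMeasure P] {b C : ℝ} (hb : 0 ≤ b) (r : ℝ) :
    ∀ (n : ℕ) (f : (Fin n → Ω) → ℝ), Measurable f → (∀ x, |f x| ≤ C) →
      (∀ x i z, |f x - f (Function.update x i z)| ≤ b) →
      ∫ x, Real.exp (r * (f x - ∫ y, f y ∂Measure.pi fun _ => P)) ∂(Measure.pi fun _ => P) ≤
        Real.exp (n * b ^ 2 * r ^ 2 / 2)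
  | 0, f, _, _, _ => by
    have : ∀ x, f x = f default := fun x => congrArg f (Subsingleton.elim _ _)
    simp [this]
  | n + 1, f, hf, hC, hd => by
    set π : Measure (Fin n → Ω) := Measure.pi fun _ => P with hπ
    have hmp := measurePreserving_piFinSuccAbove (fun _ : Fin (n + 1) => P) 0
    have hmeas : Measurable fun p : Ω × (Fin n → Ω) => (Fin.cons p.1 p.2 : Fin (n + 1) → Ω) := by
      refine measurable_pi_iff.2 fun i => ?_
      refine Fin.cases ?_ (fun j => ?_) i
      · simpa using measurable_fst
      · simp only [Fin.cons_succ]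
        exact (measurable_pi_apply j).comp measurable_snd
    have hfub : ∀ (F : (Fin (n + 1) → Ω) → ℝ), Measurable F → (∃ K, ∀ x, |F x| ≤ K) →
        ∫ x, F x ∂(Measure.pi fun _ => P) = ∫ y, ∫ z, F (Fin.cons z y) ∂P ∂π := by
      rintro F hF ⟨K, hK⟩
      have h1 : ∫ x, F x ∂(Measure.pi fun _ => P) =
          ∫ p : Ω × (Fin n → Ω), F (Fin.cons p.1 p.2) ∂(P.prod π) := by
        rw [← hmp.symm.integral_comp']
        refine integral_congr_ae (ae_of_all _ fun p => ?_)
        exact congrArg F (Fin.insertNth_zero' p.1 p.2)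
      rw [h1, integral_prod_symm]
      exact Integrable.of_bound (hF.comp hmeas).aestronglyMeasurable K
        (ae_of_all _ fun p => hK _)
    set g : (Fin n → Ω) → ℝ := fun y => ∫ z, f (Fin.cons z y) ∂P with hg
    have hfy : ∀ y : Fin n → Ω, Measurable fun z => f (Fin.cons z y) := fun y =>
      (hf.comp hmeas).comp measurable_prodMk_right
    have hgm : Measurable g := by
      refine StronglyMeasurable.measurable ?_
      have : Measurable fun p : (Fin n → Ω) × Ω => f (Fin.cons p.2 p.1) :=
        (hf.comp hmeas).comp measurable_swap
      exact this.stronglyMeasurable.integral_prod_right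
    have hfi : ∀ y : Fin n → Ω, Integrable (fun z => f (Fin.cons z y)) P := fun y =>
      Integrable.of_bound (hfy y).aestronglyMeasurable C (ae_of_all _ fun z => hC _)
    have hgC : ∀ y, |g y| ≤ C := fun y => by
      have := norm_integral_le_of_norm_le_const (μ := P) (f := fun z => f (Fin.cons z y))
        (ae_of_all _ fun z => hC _)
      simpa using this
    have hgd : ∀ y i w, |g y - g (Function.update y i w)| ≤ b := by
      intro y i w
      have h1 : g y - g (Function.update y i w) =
          ∫ z, (f (Fin.cons z y) - f (Fin.cons z (Function.update y i w))) ∂P :=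
        (integral_sub (hfi _) (hfi _)).symm
      rw [h1]
      have := norm_integral_le_of_norm_le_const (μ := P)
        (f := fun z => f (Fin.cons z y) - f (Fin.cons z (Function.update y i w))) (C := b)
        (ae_of_all _ fun z => by
          have := hd (Fin.cons z y) i.succ w
          rwa [← Fin.cons_update] at this)
      simpa using this
    have hmean : ∫ x, f x ∂(Measure.pi fun _ => P) = ∫ y, g y ∂π := hfub f hf ⟨C, hC⟩
    have ih := integral_exp_mul_sub_integral_le_of_bounded_differences P hb r n g hgm hgC hgd
    rw [hmean]
    set m : ℝ := ∫ y, g y ∂π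
    have hexpC : ∀ (u : ℝ), |u| ≤ C → |Real.exp (r * (u - m))| ≤ Real.exp (|r| * (C + |m|)) := by
      intro u hu
      rw [abs_of_pos (Real.exp_pos _), Real.exp_le_exp]
      calc r * (u - m) ≤ |r| * |u - m| := by rw [← abs_mul]; exact le_abs_self _
        _ ≤ |r| * (C + |m|) := by
          gcongr
          exact (abs_sub _ _).trans (by linarith)
    rw [hfub (fun x => Real.exp (r * (f x - m))) (by fun_prop) ⟨_, fun x => hexpC _ (hC x)⟩]
    have hinner : ∀ y : Fin n → Ω, ∫ z, Real.exp (r * (f (Fin.cons z y) - m)) ∂P ≤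
        Real.exp (r * (g y - m)) * Real.exp (b ^ 2 * r ^ 2 / 2) := by
      intro y
      obtain ⟨z₀⟩ : Nonempty Ω := nonempty_of_isProbabilityMeasure P
      have hsub := ProbabilityTheory.hasSubgaussianMGF_of_mem_Icc (μ := P)
        (X := fun z => f (Fin.cons z y)) (a := f (Fin.cons z₀ y) - b)
        (b := f (Fin.cons z₀ y) + b) (hfy y).aemeasurable (ae_of_all _ fun z => by
          have := hd (Fin.cons z₀ y) 0 z
          rw [Fin.update_cons_zero, abs_le] at this
          exact ⟨by linarith, by linarith⟩)
      have h1 := hsub.mgf_le r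
      have h2 : (((‖f (Fin.cons z₀ y) + b - (f (Fin.cons z₀ y) - b)‖₊ / 2) ^ 2 : NNReal) : ℝ) =
          b ^ 2 := by
        rw [show f (Fin.cons z₀ y) + b - (f (Fin.cons z₀ y) - b) = 2 * b by ring]
        simp [abs_of_nonneg hb]
      rw [h2] at h1
      calc ∫ z, Real.exp (r * (f (Fin.cons z y) - m)) ∂P
          = ∫ z, Real.exp (r * (g y - m)) * Real.exp (r * (f (Fin.cons z y) - g y)) ∂P := by
            refine integral_congr_ae (ae_of_all _ fun z => ?_)
            simp only
            rw [← Real.exp_add]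
            ring_nf
        _ = Real.exp (r * (g y - m)) * ∫ z, Real.exp (r * (f (Fin.cons z y) - g y)) ∂P :=
            integral_const_mul _ _
        _ ≤ _ := mul_le_mul_of_nonneg_left h1 (Real.exp_pos _).le
    have hgi : Integrable (fun y => Real.exp (r * (g y - m))) π :=
      Integrable.of_bound (by fun_prop) _ (ae_of_all _ fun y => hexpC _ (hgC y))
    have hout : Measurable fun y : Fin n → Ω => ∫ z, Real.exp (r * (f (Fin.cons z y) - m)) ∂P := by
      refine StronglyMeasurable.measurable ?_
      have : Measurable fun p : (Fin n → Ω) × Ω => Real.exp (r * (f (Fin.cons p.2 p.1) - m)) := by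
        have := (hf.comp hmeas).comp (measurable_swap (α := Fin n → Ω) (β := Ω))
        simp only [Function.comp_def, Prod.fst_swap, Prod.snd_swap] at this
        fun_prop
      exact this.stronglyMeasurable.integral_prod_right
    calc ∫ y, ∫ z, Real.exp (r * (f (Fin.cons z y) - m)) ∂P ∂π
        ≤ ∫ y, Real.exp (r * (g y - m)) * Real.exp (b ^ 2 * r ^ 2 / 2) ∂π := by
          refine integral_mono_of_nonneg (ae_of_all _ fun y => integral_nonneg fun z =>
            (Real.exp_pos _).le) (hgi.mul_const _) (ae_of_all _ hinner)
      _ = (∫ y, Real.exp (r * (g y - m)) ∂π) * Real.exp (b ^ 2 * r ^ 2 / 2) :=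
          integral_mul_const _ _
      _ ≤ Real.exp (n * b ^ 2 * r ^ 2 / 2) * Real.exp (b ^ 2 * r ^ 2 / 2) := by gcongr
      _ = Real.exp ((n + 1 : ℕ) * b ^ 2 * r ^ 2 / 2) := by
          rw [← Real.exp_add]
          push_cast
          ring_nf

theorem measure_le_of_bounded_differences {Ω : Type*} [MeasurableSpace Ω]
    (P : Measure Ω) [IsProbabilityMeasure P] {b C t : ℝ} (hb : 0 < b) {n : ℕ} (hn : 1 ≤ n)
    (ht : 0 < t) {f : (Fin n → Ω) → ℝ} (hf : Measurable f) (hC : ∀ x, |f x| ≤ C)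
    (hd : ∀ x i z, |f x - f (Function.update x i z)| ≤ b) :
    (Measure.pi fun _ : Fin n => P)
      {x | ∫ y, f y ∂(Measure.pi fun _ : Fin n => P) + b * √(2 * n * t) ≤ f x} ≤
      ENNReal.ofReal (Real.exp (-t)) := by
  set π : Measure (Fin n → Ω) := Measure.pi fun _ => P
  set m : ℝ := ∫ y, f y ∂π
  have hnpos : (0 : ℝ) < n := by exact_mod_cast hn
  -- the optimal parameter in Chernoff's bound
  set r : ℝ := √(2 * n * t) / (n * b) with hr
  have hr0 : 0 ≤ r := by positivity
  have hint : Integrable (fun x => Real.exp (r * (f x - m))) π := by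
    refine Integrable.of_bound (by fun_prop) (Real.exp (r * (C + |m|))) (ae_of_all _ fun x => ?_)
    rw [Real.norm_eq_abs, abs_of_pos (Real.exp_pos _), Real.exp_le_exp]
    refine mul_le_mul_of_nonneg_left ?_ hr0
    linarith [le_abs_self (f x), hC x, neg_abs_le m]
  have h1 := ProbabilityTheory.measure_ge_le_exp_mul_mgf (μ := π) (X := fun x => f x - m)
    (b * √(2 * n * t)) hr0 hint
  have h2 := integral_exp_mul_sub_integral_le_of_bounded_differences P hb.le r n f hf hC hd
  have hsq : √(2 * n * t) ^ 2 = 2 * n * t := Real.sq_sqrt (by positivity)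
  have h3 : Real.exp (-r * (b * √(2 * n * t))) * ProbabilityTheory.mgf (fun x => f x - m) π r ≤
      Real.exp (-t) := by
    calc _ ≤ Real.exp (-r * (b * √(2 * n * t))) * Real.exp (n * b ^ 2 * r ^ 2 / 2) :=
          mul_le_mul_of_nonneg_left h2 (Real.exp_pos _).le
      _ = Real.exp (-t) := by
          rw [← Real.exp_add]
          congr 1
          have e1 : r * b * n = √(2 * n * t) := by
            rw [hr]
            field_simp
          have e2 : r * (b * √(2 * n * t)) = 2 * t := by
            have : n * (r * (b * √(2 * n * t))) = n * (2 * t) := by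
              calc _ = (r * b * n) * √(2 * n * t) := by ring
                _ = n * (2 * t) := by rw [e1, ← sq, hsq]; ring
            exact mul_left_cancel₀ hnpos.ne' this
          have e3 : n * b ^ 2 * r ^ 2 = 2 * t := by
            rw [← e2, ← e1]
            ring
          rw [e3]
          linarith
  rw [← ofReal_measureReal]
  refine ENNReal.ofReal_le_ofReal (le_trans ?_ (h1.trans h3))
  refine le_of_eq ?_
  congr 1
  ext x
  simp only [mem_ofPred_eq]
  constructor <;> intro h <;> linarith

/-! ### Chaining for the deviation of empirical means -/

/-- The expectation of `g` minus its mean over the sample `S`. -/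
noncomputable def meanDeviation {Ω : Type*} [MeasurableSpace Ω] (P : Measure Ω) {N : ℕ} (g : Ω → ℝ)
    (S : Fin N → Ω) : ℝ :=
  ∫ z, g z ∂P - (N : ℝ)⁻¹ * ∑ i, g (S i)

section MeanDeviation

variable {Ω : Type*} [MeasurableSpace Ω] {P : Measure Ω} {N : ℕ}

theorem meanDeviation_sub {g g' : Ω → ℝ} (hg : Integrable g P) (hg' : Integrable g' P)
    (S : Fin N → Ω) :
    meanDeviation P (fun z => g z - g' z) S = meanDeviation P g S - meanDeviation P g' S := by
  simp only [meanDeviation, integral_sub hg hg', Finset.sum_sub_distrib]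
  ring

theorem measurable_meanDeviation {g : Ω → ℝ} (hg : Measurable g) :
    Measurable fun S : Fin N → Ω => meanDeviation P g S := by
  unfold meanDeviation
  fun_prop

theorem abs_meanDeviation_sub_update_le {g : Ω → ℝ} {B : ℝ} (h0 : ∀ z, 0 ≤ g z)
    (hB : ∀ z, g z ≤ B) (S : Fin N → Ω) (i : Fin N) (z : Ω) :
    |meanDeviation P g S - meanDeviation P g (Function.update S i z)| ≤ B / N := by
  have h1 : ∑ j, g (Function.update S i z j) - ∑ j, g (S j) = g z - g (S i) := by
    rw [← Finset.sum_sub_distrib, Finset.sum_eq_single i]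
    · simp
    · intro j _ hj
      simp [hj]
    · simp
  have h2 : meanDeviation P g S - meanDeviation P g (Function.update S i z) =
      (g z - g (S i)) / N := by
    rw [← h1]
    simp only [meanDeviation]
    ring
  rw [h2, abs_div, Nat.abs_cast]
  gcongr
  rw [abs_le]
  constructor <;> linarith [h0 z, hB z, h0 (S i), hB (S i)]

variable [IsProbabilityMeasure P]

theorem abs_meanDeviation_le {g : Ω → ℝ} {C : ℝ} (hC : ∀ z, |g z| ≤ C) (hN : 1 ≤ N)
    (S : Fin N → Ω) : |meanDeviation P g S| ≤ 2 * C := by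
  have hN0 : (0 : ℝ) < N := by exact_mod_cast hN
  have h1 : |∫ z, g z ∂P| ≤ C := by
    simpa using norm_integral_le_of_norm_le_const (μ := P) (f := g) (ae_of_all _ hC)
  have h2 : |(N : ℝ)⁻¹ * ∑ i, g (S i)| ≤ C := by
    rw [abs_mul, abs_of_pos (inv_pos.2 hN0), inv_mul_le_iff₀ hN0]
    refine (Finset.abs_sum_le_sum_abs _ _).trans ?_
    simpa using Finset.sum_le_card_nsmul Finset.univ (fun i => |g (S i)|) C fun i _ => hC _
  calc |meanDeviation P g S| ≤ |∫ z, g z ∂P| + |(N : ℝ)⁻¹ * ∑ i, g (S i)| := abs_sub _ _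
    _ ≤ 2 * C := by linarith

/-- Hoeffding's lemma for empirical means. -/
theorem hasSubgaussianMGF_meanDeviation {g : Ω → ℝ} (hg : Measurable g) {δ : ℝ}
    (hδ : ∀ z, |g z| ≤ δ) (hN : 1 ≤ N) :
    ProbabilityTheory.HasSubgaussianMGF (fun S : Fin N → Ω => meanDeviation P g S)
      (δ ^ 2 / N).toNNReal (Measure.pi fun _ => P) := by
  obtain ⟨z₀⟩ : Nonempty Ω := nonempty_of_isProbabilityMeasure P
  have hδ0 : 0 ≤ δ := (abs_nonneg _).trans (hδ z₀)
  have hN0 : (0 : ℝ) < N := by exact_mod_cast hN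
  have h1 := ProbabilityTheory.hasSubgaussianMGF_of_mem_Icc (μ := P) (X := g) (a := -δ) (b := δ)
    hg.aemeasurable (ae_of_all _ fun z => abs_le.1 (hδ z))
  have hind : ProbabilityTheory.iIndepFun
      (fun (i : Fin N) (S : Fin N → Ω) => g (S i) - ∫ z, g z ∂P) (Measure.pi fun _ => P) :=
    ProbabilityTheory.iIndepFun_pi (μ := fun _ : Fin N => P)
      (X := fun _ z => g z - ∫ z, g z ∂P) fun i => by fun_prop
  have h2 : ∀ i ∈ (Finset.univ : Finset (Fin N)), ProbabilityTheory.HasSubgaussianMGF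
      (fun S : Fin N → Ω => g (S i) - ∫ z, g z ∂P) ((‖δ - -δ‖₊ / 2) ^ 2)
      (Measure.pi fun _ => P) := by
    intro i _
    have hmap : (Measure.pi fun _ : Fin N => P).map (fun S => S i) = P :=
      (measurePreserving_eval (fun _ : Fin N => P) i).map_eq
    exact ProbabilityTheory.HasSubgaussianMGF.of_map (μ := Measure.pi fun _ : Fin N => P)
      (Y := fun S => S i) (X := fun z => g z - ∫ z, g z ∂P) (measurable_pi_apply i).aemeasurable
      (by rw [hmap]; exact h1)
  have h3 := (ProbabilityTheory.HasSubgaussianMGF.sum_of_iIndepFun hind h2).const_mul (-(N : ℝ)⁻¹)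
  convert h3 using 1
  · funext S
    simp only [meanDeviation, Finset.sum_sub_distrib, Finset.sum_const, Finset.card_univ,
      Fintype.card_fin, nsmul_eq_mul]
    field_simp
    ring
  · ext
    rw [Real.coe_toNNReal _ (by positivity)]
    have : ‖δ - -δ‖ / 2 = δ := by
      rw [sub_neg_eq_add, Real.norm_of_nonneg (by linarith)]
      ring
    have hsum : ((∑ _i : Fin N, (‖δ - -δ‖₊ / 2) ^ 2 : NNReal) : ℝ) = N * δ ^ 2 := by
      simp only [Finset.sum_const, Finset.card_univ, Fintype.card_fin, nsmul_eq_mul,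
        NNReal.coe_mul, NNReal.coe_pow, NNReal.coe_div, coe_nnnorm, NNReal.coe_natCast,
        NNReal.coe_ofNat, this]
    change δ ^ 2 / N = (-(N : ℝ)⁻¹) ^ 2 * ((∑ _i : Fin N, (‖δ - -δ‖₊ / 2) ^ 2 : NNReal) : ℝ)
    rw [hsum]
    field_simp

/-- Finite chaining: the points of the level `s (k + 1)` are linked by `p k` to the level `s k`,
and the increments along the links are bounded by `δ k`. -/
theorem integral_sup'_meanDeviation_le_sum {Θ : Type*} {h : Θ → Ω → ℝ} {s : ℕ → Finset Θ}
    (hs : ∀ k, (s k).Nonempty) (hs0 : (s 0).card = 1) {p : ℕ → Θ → Θ}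
    (hp : ∀ k, ∀ x ∈ s (k + 1), p k x ∈ s k) {δ : ℕ → ℝ}
    (hinc : ∀ k, ∀ x ∈ s (k + 1), ∀ z, |h x z - h (p k x) z| ≤ δ k)
    (hm : ∀ k, ∀ x ∈ s k, Measurable (h x)) {C : ℝ} (hC : ∀ k, ∀ x ∈ s k, ∀ z, |h x z| ≤ C)
    (hN : 1 ≤ N) (k : ℕ) :
    ∫ S : Fin N → Ω, (s k).sup' (hs k) (fun x => meanDeviation P (h x) S)
        ∂(Measure.pi fun _ => P) ≤
      ∑ j ∈ Finset.range k, √(2 * Real.log (s (j + 1)).card * (δ j ^ 2 / N)) := by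
  have hsub : ∀ k, ∀ x ∈ s k, ProbabilityTheory.HasSubgaussianMGF
      (fun S : Fin N → Ω => meanDeviation P (h x) S) (C ^ 2 / N).toNNReal
      (Measure.pi fun _ => P) := fun k x hx =>
    hasSubgaussianMGF_meanDeviation (hm k x hx) (hC k x hx) hN
  have hint : ∀ k, ∀ x ∈ s k, Integrable (h x) P := fun k x hx =>
    Integrable.of_bound (hm k x hx).aestronglyMeasurable C (ae_of_all _ (hC k x hx))
  induction k with
  | zero =>
    refine (integral_sup'_le_of_hasSubgaussianMGF (s 0) (hs 0) (hsub 0)).trans ?_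
    simp [hs0]
  | succ k ih =>
    have hsubinc : ∀ x ∈ s (k + 1), ProbabilityTheory.HasSubgaussianMGF
        (fun S : Fin N → Ω => meanDeviation P (fun z => h x z - h (p k x) z) S)
        (δ k ^ 2 / N).toNNReal (Measure.pi fun _ => P) := fun x hx =>
      hasSubgaussianMGF_meanDeviation ((hm _ x hx).sub (hm k _ (hp k x hx))) (hinc k x hx) hN
    have hpt : ∀ S : Fin N → Ω, (s (k + 1)).sup' (hs (k + 1)) (fun x => meanDeviation P (h x) S) ≤
        (s (k + 1)).sup' (hs (k + 1))
          (fun x => meanDeviation P (fun z => h x z - h (p k x) z) S) +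
        (s k).sup' (hs k) (fun x => meanDeviation P (h x) S) := by
      intro S
      refine Finset.sup'_le _ _ fun x hx => ?_
      have h1 := Finset.le_sup'
        (fun x => meanDeviation P (fun z => h x z - h (p k x) z) S) hx
      have h2 := Finset.le_sup' (fun x => meanDeviation P (h x) S) (hp k x hx)
      have h3 := meanDeviation_sub (hint _ x hx) (hint k _ (hp k x hx)) S
      linarith
    have hi1 := integrable_finset_sup' (s (k + 1)) (hs (k + 1)) fun x hx =>
      (hsubinc x hx).integrable
    have hi2 := integrable_finset_sup' (s k) (hs k) fun x hx => (hsub k x hx).integrable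
    have hi3 := integrable_finset_sup' (s (k + 1)) (hs (k + 1)) fun x hx =>
      (hsub (k + 1) x hx).integrable
    have h4 := integral_mono hi3 (hi1.add hi2) hpt
    simp only [Pi.add_apply] at h4
    rw [integral_add hi1 hi2] at h4
    have h5 := integral_sup'_le_of_hasSubgaussianMGF (s (k + 1)) (hs (k + 1)) hsubinc
    rw [Real.coe_toNNReal _ (by positivity)] at h5
    rw [Finset.sum_range_succ]
    linarith

theorem sum_range_add_two_div_two_pow_le (k : ℕ) :
    ∑ j ∈ Finset.range k, ((j : ℝ) + 2) / 2 ^ j ≤ 6 := by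
  have h : ∀ k : ℕ, ∑ j ∈ Finset.range k, ((j : ℝ) + 2) / 2 ^ j = 6 - (2 * k + 6) / 2 ^ k := by
    intro k
    induction k with
    | zero => norm_num
    | succ k ih =>
      rw [Finset.sum_range_succ, ih, pow_succ]
      push_cast
      field_simp
      ring
  rw [h]
  have : (0 : ℝ) ≤ (2 * k + 6) / 2 ^ k := by positivity
  linarith

/-- The contribution of the `k`-th link to the chaining sum. -/
theorem sqrt_log_card_mul_le {m n k N : ℕ} {A G Λ D : ℝ} (hm : 1 ≤ m) (hA : 1 ≤ A) (hG : 0 ≤ G)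
    (hΛ : 1 ≤ Λ) (hAΛ : Real.log (3 * A) ≤ Λ) (hn : (n : ℝ) ≤ 2 * D)
    (hcard : (m : ℝ) ≤ (3 / (1 / (A * 2 ^ (k + 1)))) ^ n) :
    √(2 * Real.log m * ((2 * G / 2 ^ k) ^ 2 / N)) ≤
      (k + 2) / 2 ^ k * (4 * G * √(D * Λ) / √N) := by
  have hD : 0 ≤ D := by
    have : (0 : ℝ) ≤ n := n.cast_nonneg
    linarith
  have hlog : Real.log m ≤ 2 * D * (Λ * (k + 2)) := by
    calc Real.log m ≤ Real.log ((3 / (1 / (A * 2 ^ (k + 1)))) ^ n) :=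
          Real.log_le_log (by exact_mod_cast hm) hcard
      _ = n * (Real.log (3 * A) + (k + 1) * Real.log 2) := by
          rw [Real.log_pow, show 3 / (1 / (A * 2 ^ (k + 1))) = (3 * A) * 2 ^ (k + 1) by
            field_simp, Real.log_mul (by positivity) (by positivity), Real.log_pow]
          push_cast
          ring
      _ ≤ 2 * D * (Λ * (k + 2)) := by
          have h2 : Real.log 2 ≤ 1 := by linarith [Real.log_two_lt_d9]
          have hk : (0 : ℝ) ≤ (k : ℝ) + 1 := by positivity
          have h3 : Real.log (3 * A) + (k + 1) * Real.log 2 ≤ Λ * (k + 2) := by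
            nlinarith [mul_le_mul_of_nonneg_left h2 hk, mul_le_mul_of_nonneg_left hΛ hk]
          have h4 : 0 ≤ Λ * (k + 2) := by positivity
          exact (mul_le_mul_of_nonneg_left h3 n.cast_nonneg).trans
            (mul_le_mul_of_nonneg_right hn h4)
  refine Real.sqrt_le_iff.2 ⟨by positivity, ?_⟩
  have e : ((k + 2) / 2 ^ k * (4 * G * √(D * Λ) / √N)) ^ 2 =
      2 * (2 * D * (Λ * (k + 2) ^ 2)) * ((2 * G / 2 ^ k) ^ 2 / N) := by
    rw [mul_pow, div_pow, div_pow, mul_pow, Real.sq_sqrt (by positivity),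
      Real.sq_sqrt N.cast_nonneg]
    ring
  rw [e]
  have hk2 : ((k : ℝ) + 2) ≤ (k + 2) ^ 2 := by
    have : (0 : ℝ) ≤ k := k.cast_nonneg
    nlinarith
  have : Real.log m ≤ 2 * D * (Λ * (k + 2) ^ 2) := hlog.trans (by gcongr)
  gcongr

/-- A uniform deviation bound for a family of functions with values in `[0, B]` which is
parametrized by the unit ball of a normed space of dimension at most `2 * D`, is
`A * G`-Lipschitz in the parameter, and has diameter at most `2 * G`. The constant `A` enters only
through its logarithm. -/
theorem measure_exists_lt_meanDeviation_le {Θ : Type*} [NormedAddCommGroup Θ] [NormedSpace ℝ Θ]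
    [FiniteDimensional ℝ Θ] {h : Θ → Ω → ℝ} {A B D G Λ t : ℝ} (hN : 1 ≤ N) (ht : 0 < t)
    (hA : 1 ≤ A) (hB : 0 < B) (hG : 0 ≤ G) (hΛ : 1 ≤ Λ) (hAΛ : Real.log (3 * A) ≤ Λ)
    (hdim : (Module.finrank ℝ Θ : ℝ) ≤ 2 * D)
    (hm : ∀ θ, ‖θ‖ ≤ 1 → Measurable (h θ))
    (h0 : ∀ θ, ‖θ‖ ≤ 1 → ∀ z, 0 ≤ h θ z) (hhB : ∀ θ, ‖θ‖ ≤ 1 → ∀ z, h θ z ≤ B)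
    (hdiam : ∀ θ θ', ‖θ‖ ≤ 1 → ‖θ'‖ ≤ 1 → ∀ z, |h θ z - h θ' z| ≤ 2 * G)
    (hlip : ∀ θ θ', ‖θ‖ ≤ 1 → ‖θ'‖ ≤ 1 → ∀ z, |h θ z - h θ' z| ≤ A * G * ‖θ - θ'‖) :
    (Measure.pi fun _ : Fin N => P)
      {S | ∃ θ, ‖θ‖ ≤ 1 ∧
        24 * G * √(D * Λ) / √N + 3 * B * √(t / (2 * N)) < meanDeviation P (h θ) S} ≤
      ENNReal.ofReal (Real.exp (-t)) := by
  have hN0 : (0 : ℝ) < N := by exact_mod_cast hN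
  have hA0 : 0 < A := by linarith
  have hε : ∀ k : ℕ, 0 < 1 / (A * 2 ^ k) := fun k => by positivity
  have hε1 : ∀ k : ℕ, 1 / (A * 2 ^ k) ≤ 1 := fun k => by
    rw [div_le_one (by positivity)]
    exact one_le_mul_of_one_le_of_one_le hA (one_le_pow₀ (by norm_num))
  choose s₀ hs₀ball hs₀net hs₀card using fun k => exists_net_unitBall (E := Θ) (hε k) (hε1 k)
  -- at the coarsest level the diameter bound makes a single point suffice
  let s : ℕ → Finset Θ := fun k => match k with
    | 0 => {0}
    | k + 1 => s₀ (k + 1)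
  have hball : ∀ k, ∀ x ∈ s k, ‖x‖ ≤ 1 := by
    rintro (_ | k) x hx
    · rw [Finset.mem_singleton.1 hx, norm_zero]
      exact zero_le_one
    · exact hs₀ball _ x hx
  have hne : ∀ k, (s k).Nonempty := by
    rintro (_ | k)
    · exact Finset.singleton_nonempty 0
    · obtain ⟨y, hy, -⟩ := hs₀net (k + 1) 0 (by simp)
      exact ⟨y, hy⟩
  have hlink : ∀ k, ∀ x, ‖x‖ ≤ 1 → ∃ y ∈ s k, ∀ z, |h x z - h y z| ≤ 2 * G / 2 ^ k := by
    rintro (_ | k) x hx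
    · exact ⟨0, Finset.mem_singleton_self 0, fun z => by
        simpa using hdiam x 0 hx (by simp) z⟩
    · obtain ⟨y, hy, hxy⟩ := hs₀net (k + 1) x hx
      refine ⟨y, hy, fun z => (hlip x y hx (hs₀ball _ y hy) z).trans ?_⟩
      calc A * G * ‖x - y‖ ≤ A * G * (1 / (A * 2 ^ (k + 1))) := by gcongr
        _ = G / 2 ^ (k + 1) := by field_simp
        _ ≤ 2 * G / 2 ^ (k + 1) := by
          gcongr
          linarith
  choose! p hps hpd using hlink
  have habs : ∀ θ, ‖θ‖ ≤ 1 → ∀ z, |h θ z| ≤ B := fun θ hθ z => by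
    rw [abs_of_nonneg (h0 θ hθ z)]
    exact hhB θ hθ z
  have hexp : ∀ k, ∫ S : Fin N → Ω, (s k).sup' (hne k) (fun x => meanDeviation P (h x) S)
      ∂(Measure.pi fun _ => P) ≤ 24 * G * √(D * Λ) / √N := by
    intro k
    refine (integral_sup'_meanDeviation_le_sum hne (Finset.card_singleton 0)
      (fun k x hx => hps k x (hball (k + 1) x hx)) (δ := fun k => 2 * G / 2 ^ k)
      (fun k x hx => hpd k x (hball (k + 1) x hx)) (fun k x hx => hm x (hball k x hx))
      (fun k x hx => habs x (hball k x hx)) hN k).trans ?_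
    calc _ ≤ ∑ j ∈ Finset.range k, ((j : ℝ) + 2) / 2 ^ j * (4 * G * √(D * Λ) / √N) :=
          Finset.sum_le_sum fun j _ => sqrt_log_card_mul_le
            (Finset.card_pos.2 (hne (j + 1))) hA hG hΛ hAΛ hdim (hs₀card (j + 1))
      _ = (∑ j ∈ Finset.range k, ((j : ℝ) + 2) / 2 ^ j) * (4 * G * √(D * Λ) / √N) :=
          (Finset.sum_mul _ _ _).symm
      _ ≤ 6 * (4 * G * √(D * Λ) / √N) :=
          mul_le_mul_of_nonneg_right (sum_range_add_two_div_two_pow_le k) (by positivity)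
      _ = _ := by ring
  set η : ℝ := B * √(t / (2 * N)) with hη
  have hη0 : 0 < η := by positivity
  -- the finest level approximates the whole family up to the slack `η`
  obtain ⟨K, hK⟩ : ∃ K : ℕ, 2 * (2 * G / 2 ^ K) ≤ η := by
    obtain ⟨K, hK⟩ := exists_pow_lt_of_lt_one (show 0 < η / (4 * G + 1) by positivity)
      (show (1 / 2 : ℝ) < 1 by norm_num)
    refine ⟨K, ?_⟩
    rw [lt_div_iff₀ (by positivity), one_div, inv_pow] at hK
    have : (0 : ℝ) < (2 ^ K)⁻¹ := by positivity
    calc 2 * (2 * G / 2 ^ K) = (2 ^ K)⁻¹ * (4 * G) := by ring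
      _ ≤ (2 ^ K)⁻¹ * (4 * G + 1) := by gcongr; linarith
      _ ≤ η := hK.le
  set Z : (Fin N → Ω) → ℝ := fun S => (s K).sup' (hne K) fun x => meanDeviation P (h x) S with hZ
  have hZm : Measurable Z := by
    convert Finset.measurable_sup' (hne K) (f := fun x S => meanDeviation P (h x) S)
      fun x hx => measurable_meanDeviation (hm x (hball K x hx)) using 1
    funext S
    simp [hZ, Finset.sup'_apply]
  have hZb : ∀ S, |Z S| ≤ 2 * B := by
    intro S
    obtain ⟨x, hx, hxZ⟩ := Finset.exists_mem_eq_sup' (hne K) fun x => meanDeviation P (h x) S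
    rw [hZ]
    simp only
    rw [hxZ]
    exact abs_meanDeviation_le (habs x (hball K x hx)) hN S
  have hZle : ∀ S i z, Z S ≤ Z (Function.update S i z) + B / N := by
    intro S i z
    refine Finset.sup'_le _ _ fun x hx => ?_
    have h1 := Finset.le_sup' (fun x => meanDeviation P (h x) (Function.update S i z)) hx
    have h2 := abs_le.1 (abs_meanDeviation_sub_update_le (P := P) (h0 x (hball K x hx))
      (hhB x (hball K x hx)) S i z)
    linarith [h2.2]
  have hZd : ∀ S i z, |Z S - Z (Function.update S i z)| ≤ B / N := by
    intro S i z
    have h1 := hZle S i z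
    have h2 := hZle (Function.update S i z) i (S i)
    rw [Function.update_idem, Function.update_eq_self] at h2
    rw [abs_le]
    constructor <;> linarith
  refine (measure_mono ?_).trans (measure_le_of_bounded_differences P (b := B / N) (by positivity)
    hN ht hZm hZb hZd)
  rintro S ⟨θ, hθ, hS⟩
  have hηeq : B / N * √(2 * N * t) = 2 * η := by
    have h1 : √(2 * N * t) = 2 * N * √(t / (2 * N)) := by
      rw [show 2 * N * t = (2 * N) ^ 2 * (t / (2 * N)) by field_simp,
        Real.sqrt_mul (by positivity), Real.sqrt_sq (by positivity)]
    rw [h1, hη]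
    field_simp
  have happ : meanDeviation P (h θ) S ≤ Z S + η := by
    have hint : ∀ θ, ‖θ‖ ≤ 1 → Integrable (h θ) P := fun θ hθ =>
      Integrable.of_bound (hm θ hθ).aestronglyMeasurable B (ae_of_all _ (habs θ hθ))
    have hy := hball K _ (hps K θ hθ)
    have h1 := meanDeviation_sub (hint θ hθ) (hint _ hy) S
    have h2 := abs_meanDeviation_le (P := P) (hpd K θ hθ) hN S
    have h3 := Finset.le_sup' (fun x => meanDeviation P (h x) S) (hps K θ hθ)
    have h4 := (abs_le.1 h2).2
    rw [hZ]
    linarith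
  have := hexp K
  rw [mem_ofPred_eq, hηeq]
  linarith

end MeanDeviation

/-! ### The t-product under an orthogonal transform -/

namespace Tensor3

variable {m n k c : ℕ}

theorem norm_sq_eq_sum (T : Tensor3 m n c) :
    ‖T‖ ^ 2 = ∑ i, ∑ j, ∑ s, T (i, j, s) ^ 2 := by
  rw [EuclideanSpace.real_norm_sq_eq]
  simp only [Fintype.sum_prod_type]

theorem mode3_mode3 (T : Tensor3 m n c) (A B : Matrix (Fin c) (Fin c) ℝ) :
    mode3 (mode3 T A) B = mode3 T (B * A) := by
  ext p
  simp only [mode3, Matrix.mul_apply, Finset.mul_sum, Finset.sum_mul]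
  rw [Finset.sum_comm]
  simp only [mul_assoc]

theorem mode3_one (T : Tensor3 m n c) : mode3 T 1 = T := by
  ext p
  simp [mode3, Matrix.one_apply]

theorem mode3_sub (T T' : Tensor3 m n c) (A : Matrix (Fin c) (Fin c) ℝ) :
    mode3 (T - T') A = mode3 T A - mode3 T' A := by
  ext p
  simp [mode3, mul_sub]

theorem inv_mem_orthogonalGroup {M : Matrix (Fin c) (Fin c) ℝ}
    (hM : M ∈ Matrix.orthogonalGroup (Fin c) ℝ) : M⁻¹ ∈ Matrix.orthogonalGroup (Fin c) ℝ := by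
  rw [Matrix.inv_eq_right_inv ((Matrix.mem_orthogonalGroup_iff (Fin c) ℝ).1 hM)]
  exact Unitary.star_mem hM

theorem isUnit_det_of_mem_orthogonalGroup {M : Matrix (Fin c) (Fin c) ℝ}
    (hM : M ∈ Matrix.orthogonalGroup (Fin c) ℝ) : IsUnit M.det :=
  Matrix.isUnit_det_of_right_inverse ((Matrix.mem_orthogonalGroup_iff (Fin c) ℝ).1 hM)

theorem mode3_inv_mode3 {M : Matrix (Fin c) (Fin c) ℝ}
    (hM : M ∈ Matrix.orthogonalGroup (Fin c) ℝ) (T : Tensor3 m n c) :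
    mode3 (mode3 T M⁻¹) M = T := by
  rw [mode3_mode3, Matrix.mul_nonsing_inv _ (isUnit_det_of_mem_orthogonalGroup hM), mode3_one]

theorem mode3_mode3_inv {M : Matrix (Fin c) (Fin c) ℝ}
    (hM : M ∈ Matrix.orthogonalGroup (Fin c) ℝ) (T : Tensor3 m n c) :
    mode3 (mode3 T M) M⁻¹ = T := by
  rw [mode3_mode3, Matrix.nonsing_inv_mul _ (isUnit_det_of_mem_orthogonalGroup hM), mode3_one]

theorem norm_mode3 {A : Matrix (Fin c) (Fin c) ℝ} (hA : A ∈ Matrix.orthogonalGroup (Fin c) ℝ)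
    (T : Tensor3 m n c) : ‖mode3 T A‖ = ‖T‖ := by
  have h : ∀ v : Fin c → ℝ, ∑ s, (∑ s', A s s' * v s') ^ 2 = ∑ s, v s ^ 2 := by
    intro v
    have h1 : (A.mulVec v) ⬝ᵥ (A.mulVec v) = v ⬝ᵥ v := by
      rw [Matrix.dotProduct_mulVec, ← Matrix.mulVec_transpose, Matrix.mulVec_mulVec]
      have := (Matrix.mem_orthogonalGroup_iff' (Fin c) ℝ).1 hA
      rw [this, Matrix.one_mulVec]
    simpa [dotProduct, Matrix.mulVec, sq] using h1
  rw [← sq_eq_sq₀ (norm_nonneg _) (norm_nonneg _), norm_sq_eq_sum, norm_sq_eq_sum]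
  exact Finset.sum_congr rfl fun i _ => Finset.sum_congr rfl fun j _ => h fun s => T (i, j, s)

theorem tProd_sub_left (M : Matrix (Fin c) (Fin c) ℝ) (A A' : Tensor3 m n c) (B : Tensor3 n k c) :
    tProd M (A - A') B = tProd M A B - tProd M A' B := by
  rw [tProd, tProd, tProd, ← mode3_sub, mode3_sub]
  congr 1
  ext p
  simp [ofSlices, slice, Matrix.mul_apply, sub_mul]

theorem tProd_sub_right (M : Matrix (Fin c) (Fin c) ℝ) (A : Tensor3 m n c) (B B' : Tensor3 n k c) :
    tProd M A (B - B') = tProd M A B - tProd M A B' := by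
  rw [tProd, tProd, tProd, ← mode3_sub, mode3_sub]
  congr 1
  ext p
  simp [ofSlices, slice, Matrix.mul_apply, mul_sub]

/-- Cauchy–Schwarz in each transformed slice. -/
theorem norm_tProd_le {M : Matrix (Fin c) (Fin c) ℝ} (hM : M ∈ Matrix.orthogonalGroup (Fin c) ℝ)
    (A : Tensor3 m n c) (B : Tensor3 n k c) : ‖tProd M A B‖ ≤ ‖A‖ * ‖B‖ := by
  rw [tProd, norm_mode3 (inv_mem_orthogonalGroup hM), ← norm_mode3 hM A, ← norm_mode3 hM B]
  generalize mode3 A M = A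
  generalize mode3 B M = B
  refine le_of_sq_le_sq ?_ (by positivity)
  rw [mul_pow, norm_sq_eq_sum, norm_sq_eq_sum, norm_sq_eq_sum]
  have hA : ∀ s, ∑ i, ∑ j, A (i, j, s) ^ 2 ≤ ∑ i, ∑ j, ∑ s, A (i, j, s) ^ 2 := fun s =>
    Finset.sum_le_sum fun i _ => Finset.sum_le_sum fun j _ =>
      Finset.single_le_sum (f := fun s => A (i, j, s) ^ 2) (fun _ _ => sq_nonneg _)
        (Finset.mem_univ s)
  calc ∑ i, ∑ l, ∑ s, (∑ j, A (i, j, s) * B (j, l, s)) ^ 2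
      ≤ ∑ i, ∑ l, ∑ s, (∑ j, A (i, j, s) ^ 2) * ∑ j, B (j, l, s) ^ 2 := by
        gcongr with i _ l _ s _
        exact Finset.sum_mul_sq_le_sq_mul_sq _ _ _
    _ = ∑ s, (∑ i, ∑ j, A (i, j, s) ^ 2) * ∑ l, ∑ j, B (j, l, s) ^ 2 := by
        simp only [Finset.sum_mul_sum]
        rw [Finset.sum_comm]
        rw [Finset.sum_congr rfl fun l _ => Finset.sum_comm]
        rw [Finset.sum_comm]
        refine Finset.sum_congr rfl fun s _ => ?_
        rw [Finset.sum_comm]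
    _ ≤ ∑ s, (∑ i, ∑ j, ∑ s, A (i, j, s) ^ 2) * ∑ l, ∑ j, B (j, l, s) ^ 2 := by
        exact Finset.sum_le_sum fun s _ => mul_le_mul_of_nonneg_right (hA s)
          (Finset.sum_nonneg fun _ _ => Finset.sum_nonneg fun _ _ => sq_nonneg _)
    _ = (∑ i, ∑ j, ∑ s, A (i, j, s) ^ 2) * ∑ j, ∑ l, ∑ s, B (j, l, s) ^ 2 := by
        rw [← Finset.mul_sum]
        congr 1
        rw [Finset.sum_congr rfl fun s _ => Finset.sum_comm, Finset.sum_comm]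
        exact Finset.sum_congr rfl fun j _ => Finset.sum_comm

theorem norm_relu_sub_le (A B : Tensor3 m n c) : ‖relu A - relu B‖ ≤ ‖A - B‖ := by
  refine le_of_sq_le_sq ?_ (norm_nonneg _)
  rw [EuclideanSpace.real_norm_sq_eq, EuclideanSpace.real_norm_sq_eq]
  refine Finset.sum_le_sum fun p _ => sq_le_sq.2 ?_
  exact abs_max_sub_max_le_abs (A p) (B p) 0

theorem norm_relu_le (A : Tensor3 m n c) : ‖relu A‖ ≤ ‖A‖ := by
  have h0 : relu (0 : Tensor3 m n c) = 0 := by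
    ext p
    simp [relu]
  simpa [h0] using norm_relu_sub_le A 0

/-! ### Tubal rank and factorization -/

/-- The columns of a transformed slice of a tensor of tubal rank at most `r` lie in the span of
the at most `r` columns of the left factor of a t-SVD that belong to non-zero tubes. -/
theorem exists_subspace_of_tubalRank_le {M : Matrix (Fin c) (Fin c) ℝ}
    (hM : M ∈ Matrix.orthogonalGroup (Fin c) ℝ) {T : Tensor3 m n c} {r : ℕ}
    (hT : tubalRank M T ≤ r) (s : Fin c) :
    ∃ V : Submodule ℝ (EuclideanSpace ℝ (Fin m)), Module.finrank ℝ V ≤ r ∧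
      ∀ j, WithLp.toLp 2 (fun i => mode3 T M (i, j, s)) ∈ V := by
  classical
  have hlt : tubalRank M T < ((r + 1 : ℕ) : ℕ∞) :=
    hT.trans_lt (by exact_mod_cast Nat.lt_succ_self r)
  simp only [tubalRank, iInf_lt_iff] at hlt
  obtain ⟨U, S, V, ⟨-, -, hdiag, hTeq⟩, hnum⟩ := hlt
  set I : Set (Fin (min m n)) := {i | ∃ s : Fin c,
    S (Fin.castLE (min_le_left m n) i, Fin.castLE (min_le_right m n) i, s) ≠ 0} with hI
  have hIcard : I.toFinset.card ≤ r := by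
    have h1 : I.encard < ((r + 1 : ℕ) : ℕ∞) := hnum
    rw [Set.encard_eq_coe_toFinset_card, Nat.cast_lt] at h1
    omega
  let u : Fin m → EuclideanSpace ℝ (Fin m) := fun i' => WithLp.toLp 2 fun i => mode3 U M (i, i', s)
  let F : Finset (EuclideanSpace ℝ (Fin m)) :=
    I.toFinset.image fun i => u (Fin.castLE (min_le_left m n) i)
  refine ⟨Submodule.span ℝ (F : Set (EuclideanSpace ℝ (Fin m))),
    (finrank_span_finset_le_card F).trans (Finset.card_image_le.trans hIcard), fun j => ?_⟩
  have hcol : (WithLp.toLp 2 fun i => mode3 T M (i, j, s) : EuclideanSpace ℝ (Fin m)) =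
      ∑ i', (∑ j', mode3 S M (i', j', s) * mode3 (tTranspose M V) M (j', j, s)) • u i' := by
    ext i
    rw [hTeq]
    simp only [tProd, mode3_inv_mode3 hM]
    simp only [ofSlices, slice, Matrix.mul_apply, Matrix.of_apply, WithLp.ofLp_sum,
      Finset.sum_apply, PiLp.smul_apply, smul_eq_mul, u, Finset.sum_mul]
    rw [Finset.sum_comm]
    refine Finset.sum_congr rfl fun _ _ => Finset.sum_congr rfl fun _ _ => ?_
    ring
  rw [hcol]
  refine Submodule.sum_mem _ fun i' _ => ?_
  by_cases hi' : u i' ∈ F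
  · exact Submodule.smul_mem _ _ (Submodule.subset_span hi')
  · -- the tube at `(i', i')` vanishes or does not exist
    have hzero : ∀ j', mode3 S M (i', j', s) = 0 := by
      intro j'
      simp only [mode3]
      refine Finset.sum_eq_zero fun s' _ => ?_
      by_cases hij : (i' : ℕ) = j'
      · by_contra hne
        apply hi'
        have hlt : (i' : ℕ) < min m n := lt_min i'.2 (hij ▸ j'.2)
        refine Finset.mem_image.2 ⟨⟨i', hlt⟩, ?_, rfl⟩
        rw [Set.mem_toFinset]
        refine ⟨s', fun h0 => hne ?_⟩
        have e : (Fin.castLE (min_le_right m n) ⟨i', hlt⟩ : Fin n) = j' := Fin.ext hij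
        rw [e] at h0
        rw [mul_eq_zero]
        exact Or.inr h0
      · rw [hdiag i' j' s' hij, mul_zero]
    simp [hzero]

/-- A subspace of dimension at most `r` is isometrically parametrized by a contraction from
Euclidean `r`-space. -/
theorem exists_contraction_of_finrank_le {E : Type*} [NormedAddCommGroup E]
    [InnerProductSpace ℝ E] [FiniteDimensional ℝ E] {r : ℕ} (V : Submodule ℝ E)
    (hV : Module.finrank ℝ V ≤ r) :
    ∃ P : EuclideanSpace ℝ (Fin r) →L[ℝ] E, ‖P‖ ≤ 1 ∧ ∀ v ∈ V, ∃ q, ‖q‖ = ‖v‖ ∧ P q = v := by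
  let b := stdOrthonormalBasis ℝ V
  let f : V →ₗ[ℝ] EuclideanSpace ℝ (Fin r) :=
    b.toBasis.constr ℝ fun i => EuclideanSpace.basisFun (Fin r) ℝ (Fin.castLE hV i)
  have hf : Orthonormal ℝ (f ∘ b.toBasis) := by
    have : f ∘ b.toBasis = EuclideanSpace.basisFun (Fin r) ℝ ∘ Fin.castLE hV := by
      funext i
      simp [f]
    rw [this]
    exact (EuclideanSpace.basisFun (Fin r) ℝ).orthonormal.comp _ (Fin.castLE_injective hV)
  let T : V →ₗᵢ[ℝ] EuclideanSpace ℝ (Fin r) :=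
    f.isometryOfOrthonormal (v := b.toBasis) (by simp) hf
  refine ⟨V.subtypeL ∘L ContinuousLinearMap.adjoint T.toContinuousLinearMap, ?_, fun v hv => ?_⟩
  · refine (ContinuousLinearMap.opNorm_comp_le _ _).trans ?_
    rw [LinearIsometryEquiv.norm_map]
    exact mul_le_one₀ V.norm_subtypeL_le (norm_nonneg _) T.norm_toContinuousLinearMap_le
  · refine ⟨T ⟨v, hv⟩, by simp, ?_⟩
    have h1 : ContinuousLinearMap.adjoint T.toContinuousLinearMap (T ⟨v, hv⟩) = ⟨v, hv⟩ := by
      refine ext_inner_right ℝ fun w => ?_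
      rw [ContinuousLinearMap.adjoint_inner_left]
      exact T.inner_map_map _ _
    rw [ContinuousLinearMap.comp_apply, h1]
    rfl

/-- Parameters of a tensor whose transformed slices have rank at most `r`: a linear map from
Euclidean `r`-space for each slice, with the operator norm, and the coordinates of all the columns
of all the slices, with the Euclidean norm. The operator norm keeps the unit ball free of a factor
depending on `r`. -/
abbrev FactorParam (m n r c : ℕ) : Type :=
  (Fin c → (EuclideanSpace ℝ (Fin r) →L[ℝ] EuclideanSpace ℝ (Fin m))) ×
    PiLp 2 fun _ : Fin c × Fin n => EuclideanSpace ℝ (Fin r)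

/-- The tensor whose `s`-th transformed slice has columns `P s (q (s, j))`. -/
noncomputable def ofFactors (M : Matrix (Fin c) (Fin c) ℝ) {r : ℕ}
    (P : Fin c → (EuclideanSpace ℝ (Fin r) →L[ℝ] EuclideanSpace ℝ (Fin m)))
    (q : PiLp 2 fun _ : Fin c × Fin n => EuclideanSpace ℝ (Fin r)) : Tensor3 m n c :=
  mode3 (ofSlices fun s => Matrix.of fun i j => P s (q (s, j)) i) M⁻¹

theorem norm_ofFactors_le {M : Matrix (Fin c) (Fin c) ℝ}
    (hM : M ∈ Matrix.orthogonalGroup (Fin c) ℝ) {r : ℕ}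
    (P : Fin c → (EuclideanSpace ℝ (Fin r) →L[ℝ] EuclideanSpace ℝ (Fin m)))
    (q : PiLp 2 fun _ : Fin c × Fin n => EuclideanSpace ℝ (Fin r)) :
    ‖ofFactors M P q‖ ≤ ‖P‖ * ‖q‖ := by
  rw [ofFactors, norm_mode3 (inv_mem_orthogonalGroup hM)]
  refine le_of_sq_le_sq ?_ (by positivity)
  rw [mul_pow, norm_sq_eq_sum, PiLp.norm_sq_eq_of_L2, Finset.mul_sum, Fintype.sum_prod_type]
  rw [Finset.sum_congr rfl fun i _ => Finset.sum_comm, Finset.sum_comm]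
  refine Finset.sum_le_sum fun s _ => ?_
  rw [Finset.sum_comm]
  refine Finset.sum_le_sum fun j _ => ?_
  have h1 : ∑ i, (P s (q (s, j)) i) ^ 2 = ‖P s (q (s, j))‖ ^ 2 :=
    (EuclideanSpace.real_norm_sq_eq _).symm
  change ∑ i, (P s (q (s, j)) i) ^ 2 ≤ _
  rw [h1, ← mul_pow]
  gcongr
  exact ((P s).le_opNorm _).trans (by gcongr; exact norm_le_pi_norm P s)

theorem ofFactors_sub_ofFactors (M : Matrix (Fin c) (Fin c) ℝ) {r : ℕ}
    (P P' : Fin c → (EuclideanSpace ℝ (Fin r) →L[ℝ] EuclideanSpace ℝ (Fin m)))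
    (q q' : PiLp 2 fun _ : Fin c × Fin n => EuclideanSpace ℝ (Fin r)) :
    ofFactors M P q - ofFactors M P' q' = ofFactors M (P - P') q + ofFactors M P' (q - q') := by
  ext p
  simp [ofFactors, mode3, ofSlices, mul_sub]

theorem norm_ofFactors_sub_le {M : Matrix (Fin c) (Fin c) ℝ}
    (hM : M ∈ Matrix.orthogonalGroup (Fin c) ℝ) {r : ℕ} {p p' : FactorParam m n r c}
    (hp : ‖p‖ ≤ 1) (hp' : ‖p'‖ ≤ 1) :
    ‖ofFactors M p.1 p.2 - ofFactors M p'.1 p'.2‖ ≤ 2 * ‖p - p'‖ := by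
  rw [ofFactors_sub_ofFactors]
  have h1 := norm_ofFactors_le hM (p.1 - p'.1) p.2
  have h2 := norm_ofFactors_le hM p'.1 (p.2 - p'.2)
  have h3 : ‖p.1 - p'.1‖ ≤ ‖p - p'‖ := norm_fst_le (p - p')
  have h4 : ‖p.2 - p'.2‖ ≤ ‖p - p'‖ := norm_snd_le (p - p')
  have h5 : ‖p.1 - p'.1‖ * ‖p.2‖ ≤ ‖p - p'‖ * 1 :=
    mul_le_mul h3 ((norm_snd_le p).trans hp) (norm_nonneg _) (norm_nonneg _)
  have h6 : ‖p'.1‖ * ‖p.2 - p'.2‖ ≤ 1 * ‖p - p'‖ :=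
    mul_le_mul ((norm_fst_le p').trans hp') h4 (norm_nonneg _) zero_le_one
  refine (norm_add_le _ _).trans ?_
  linarith

theorem exists_ofFactors_eq {M : Matrix (Fin c) (Fin c) ℝ}
    (hM : M ∈ Matrix.orthogonalGroup (Fin c) ℝ) {T : Tensor3 m n c} {r : ℕ}
    (hT : tubalRank M T ≤ r) {b : ℝ} (hb : 0 < b) (hTb : ‖T‖ ≤ b) :
    ∃ p : FactorParam m n r c, ‖p‖ ≤ 1 ∧ b • ofFactors M p.1 p.2 = T := by
  choose V hV hVT using exists_subspace_of_tubalRank_le hM hT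
  choose P hP hPV using fun s => exists_contraction_of_finrank_le (V s) (hV s)
  choose q hq hPq using fun s j => hPV s _ (hVT s j)
  let Q : PiLp 2 fun _ : Fin c × Fin n => EuclideanSpace ℝ (Fin r) :=
    WithLp.toLp 2 fun x => b⁻¹ • q x.1 x.2
  have hQ : ‖Q‖ = b⁻¹ * ‖T‖ := by
    rw [← sq_eq_sq₀ (norm_nonneg _) (by positivity), mul_pow, PiLp.norm_sq_eq_of_L2,
      ← norm_mode3 hM T, norm_sq_eq_sum, Fintype.sum_prod_type]
    have : ∀ s j, ‖Q (s, j)‖ ^ 2 = b⁻¹ ^ 2 * ∑ i, mode3 T M (i, j, s) ^ 2 := by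
      intro s j
      simp only [Q, norm_smul, mul_pow, hq, EuclideanSpace.real_norm_sq_eq]
      rw [Real.norm_of_nonneg (by positivity)]
    simp only [this, ← Finset.mul_sum]
    congr 1
    rw [Finset.sum_congr rfl fun s _ => Finset.sum_comm, Finset.sum_comm]
    exact Finset.sum_congr rfl fun i _ => Finset.sum_comm
  refine ⟨(P, Q), ?_, ?_⟩
  · rw [Prod.norm_def, max_le_iff]
    refine ⟨(pi_norm_le_iff_of_nonneg zero_le_one).2 hP, ?_⟩
    change ‖Q‖ ≤ 1
    rw [hQ, inv_mul_le_iff₀ hb, mul_one]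
    exact hTb
  · have h1 : (ofSlices fun s => Matrix.of fun i j => P s (Q (s, j)) i : Tensor3 m n c) =
        b⁻¹ • mode3 T M := by
      ext ⟨i, j, s⟩
      simp [ofSlices, Q, hPq]
    have h2 : mode3 (b⁻¹ • mode3 T M) M⁻¹ = b⁻¹ • mode3 (mode3 T M) M⁻¹ := by
      ext p
      simp only [mode3, PiLp.smul_apply, smul_eq_mul, Finset.mul_sum]
      exact Finset.sum_congr rfl fun s _ => Finset.sum_congr rfl fun s' _ => by ring
    rw [ofFactors, h1, h2, mode3_mode3_inv hM, smul_inv_smul₀ hb.ne']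

theorem finrank_factorParam (m n r c : ℕ) :
    Module.finrank ℝ (FactorParam m n r c) = c * (r * (n + m)) := by
  have h1 : Module.finrank ℝ (EuclideanSpace ℝ (Fin r) →L[ℝ] EuclideanSpace ℝ (Fin m)) =
      r * m := by
    rw [← (LinearMap.toContinuousLinearMap (𝕜 := ℝ) (E := EuclideanSpace ℝ (Fin r))
      (F' := EuclideanSpace ℝ (Fin m))).finrank_eq, Module.finrank_linearMap]
    simp
  have h2 : Module.finrank ℝ (PiLp 2 fun _ : Fin c × Fin n => EuclideanSpace ℝ (Fin r)) =
      c * n * r := by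
    rw [(WithLp.linearEquiv 2 ℝ (Fin c × Fin n → EuclideanSpace ℝ (Fin r))).finrank_eq,
      Module.finrank_pi_fintype]
    simp
  rw [Module.finrank_prod, Module.finrank_pi_fintype, h2]
  simp only [h1, Finset.sum_const, Finset.card_univ, Fintype.card_fin, smul_eq_mul]
  ring

end Tensor3

/-! ### Stability of t-NNs in the input and in the weights -/

namespace TNNWeights

variable {L c : ℕ} {d : ℕ → ℕ} {M : Matrix (Fin c) (Fin c) ℝ} {Bl : Fin L → ℝ} {Bw : ℝ}

theorem prod_castLE_succ (Bl : Fin L → ℝ) (l : ℕ) (h : l + 1 ≤ L) :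
    ∏ i : Fin (l + 1), Bl (Fin.castLE h i) =
      (∏ i : Fin l, Bl (Fin.castLE (Nat.le_of_succ_le h) i)) * Bl ⟨l, h⟩ :=
  Fin.prod_univ_castSucc _

theorem norm_feature_le (hM : M ∈ Matrix.orthogonalGroup (Fin c) ℝ) (hBl : ∀ l, 0 < Bl l)
    {θ : TNNWeights L c d} (hθ : ∀ l, ‖θ.layer l‖ ≤ Bl l) (x : TVec (d 0) c) :
    ∀ (l : ℕ) (h : l ≤ L),
      ‖θ.feature M x l h‖ ≤ (∏ i : Fin l, Bl (Fin.castLE h i)) * ‖x‖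
  | 0, _ => by simp [feature]
  | l + 1, h => by
    have ih := norm_feature_le hM hBl hθ x l (Nat.le_of_succ_le h)
    have hl := hθ ⟨l, h⟩
    rw [prod_castLE_succ]
    calc ‖θ.feature M x (l + 1) h‖
        ≤ ‖θ.layer ⟨l, h⟩‖ * ‖θ.feature M x l (Nat.le_of_succ_le h)‖ :=
          (Tensor3.norm_relu_le _).trans (Tensor3.norm_tProd_le hM _ _)
      _ ≤ Bl ⟨l, h⟩ * ((∏ i : Fin l, Bl (Fin.castLE (Nat.le_of_succ_le h) i)) * ‖x‖) :=
          mul_le_mul hl ih (norm_nonneg _) (hBl _).le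
      _ = _ := by ring

theorem norm_feature_sub_feature_le (hM : M ∈ Matrix.orthogonalGroup (Fin c) ℝ)
    (hBl : ∀ l, 0 < Bl l) {θ : TNNWeights L c d} (hθ : ∀ l, ‖θ.layer l‖ ≤ Bl l)
    (x x' : TVec (d 0) c) :
    ∀ (l : ℕ) (h : l ≤ L), ‖θ.feature M x l h - θ.feature M x' l h‖ ≤
      (∏ i : Fin l, Bl (Fin.castLE h i)) * ‖x - x'‖
  | 0, _ => by simp [feature]
  | l + 1, h => by
    have ih := norm_feature_sub_feature_le hM hBl hθ x x' l (Nat.le_of_succ_le h)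
    have hl := hθ ⟨l, h⟩
    rw [prod_castLE_succ]
    calc ‖θ.feature M x (l + 1) h - θ.feature M x' (l + 1) h‖
        ≤ ‖θ.layer ⟨l, h⟩‖ * ‖θ.feature M x l (Nat.le_of_succ_le h) -
            θ.feature M x' l (Nat.le_of_succ_le h)‖ := by
          refine (Tensor3.norm_relu_sub_le _ _).trans ?_
          rw [← Tensor3.tProd_sub_right]
          exact Tensor3.norm_tProd_le hM _ _
      _ ≤ Bl ⟨l, h⟩ * ((∏ i : Fin l, Bl (Fin.castLE (Nat.le_of_succ_le h) i)) * ‖x - x'‖) :=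
          mul_le_mul hl ih (norm_nonneg _) (hBl _).le
      _ = _ := by ring

theorem norm_feature_sub_feature_le_of_weights (hM : M ∈ Matrix.orthogonalGroup (Fin c) ℝ)
    (hBl : ∀ l, 0 < Bl l) {θ θ' : TNNWeights L c d} (hθ : ∀ l, ‖θ.layer l‖ ≤ Bl l)
    (hθ' : ∀ l, ‖θ'.layer l‖ ≤ Bl l) {ε : ℝ}
    (hε : ∀ l, ‖θ.layer l - θ'.layer l‖ ≤ ε * Bl l) (x : TVec (d 0) c) :
    ∀ (l : ℕ) (h : l ≤ L), ‖θ.feature M x l h - θ'.feature M x l h‖ ≤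
      l * ε * ((∏ i : Fin l, Bl (Fin.castLE h i)) * ‖x‖)
  | 0, _ => by simp [feature]
  | l + 1, h => by
    have ih := norm_feature_sub_feature_le_of_weights hM hBl hθ hθ' hε x l (Nat.le_of_succ_le h)
    have hf := norm_feature_le hM hBl hθ x l (Nat.le_of_succ_le h)
    have hl := hθ' ⟨l, h⟩
    have hl2 := hε ⟨l, h⟩
    rw [prod_castLE_succ]
    set f := θ.feature M x l (Nat.le_of_succ_le h)
    set f' := θ'.feature M x l (Nat.le_of_succ_le h)
    set Q := ∏ i : Fin l, Bl (Fin.castLE (Nat.le_of_succ_le h) i)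
    have e : Tensor3.tProd M (θ.layer ⟨l, h⟩) f - Tensor3.tProd M (θ'.layer ⟨l, h⟩) f' =
        Tensor3.tProd M (θ.layer ⟨l, h⟩ - θ'.layer ⟨l, h⟩) f +
          Tensor3.tProd M (θ'.layer ⟨l, h⟩) (f - f') := by
      rw [Tensor3.tProd_sub_left, Tensor3.tProd_sub_right]
      abel
    calc ‖θ.feature M x (l + 1) h - θ'.feature M x (l + 1) h‖
        ≤ ‖θ.layer ⟨l, h⟩ - θ'.layer ⟨l, h⟩‖ * ‖f‖ + ‖θ'.layer ⟨l, h⟩‖ * ‖f - f'‖ := by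
          refine (Tensor3.norm_relu_sub_le _ _).trans ?_
          rw [e]
          exact (norm_add_le _ _).trans
            (add_le_add (Tensor3.norm_tProd_le hM _ _) (Tensor3.norm_tProd_le hM _ _))
      _ ≤ ε * Bl ⟨l, h⟩ * (Q * ‖x‖) + Bl ⟨l, h⟩ * (l * ε * (Q * ‖x‖)) :=
          add_le_add (mul_le_mul hl2 hf (norm_nonneg _) ((norm_nonneg _).trans hl2))
            (mul_le_mul hl ih (norm_nonneg _) (hBl _).le)
      _ = _ := by
          push_cast
          ring

theorem predict_eq_inner (θ : TNNWeights L c d) (x : TVec (d 0) c) :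
    θ.predict M x = inner ℝ θ.out (θ.feature M x L le_rfl) := by
  rw [predict, PiLp.inner_apply]
  exact Finset.sum_congr rfl fun p _ => by simp [mul_comm]

theorem abs_predict_le (hM : M ∈ Matrix.orthogonalGroup (Fin c) ℝ) (hBl : ∀ l, 0 < Bl l)
    {θ : TNNWeights L c d} (hθ : ∀ l, ‖θ.layer l‖ ≤ Bl l) (hw : ‖θ.out‖ ≤ Bw)
    (x : TVec (d 0) c) : |θ.predict M x| ≤ ‖x‖ * (Bw * ∏ l, Bl l) := by
  rw [predict_eq_inner]
  refine (abs_real_inner_le_norm _ _).trans ?_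
  have h := norm_feature_le hM hBl hθ x L le_rfl
  simp only [Fin.castLE_rfl, id] at h
  calc _ ≤ Bw * ((∏ l, Bl l) * ‖x‖) :=
        mul_le_mul hw h (norm_nonneg _) ((norm_nonneg _).trans hw)
    _ = _ := by ring

theorem continuous_predict (hM : M ∈ Matrix.orthogonalGroup (Fin c) ℝ) (θ : TNNWeights L c d) :
    Continuous (θ.predict M) := by
  have h : Continuous fun x => θ.feature M x L le_rfl := by
    refine (LipschitzWith.of_dist_le' (K := ∏ l, (‖θ.layer l‖ + 1)) fun x x' => ?_).continuous
    rw [dist_eq_norm, dist_eq_norm]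
    have := norm_feature_sub_feature_le hM (Bl := fun l => ‖θ.layer l‖ + 1) (fun l => by positivity)
      (fun l => (lt_add_one _).le) x x' L le_rfl
    simpa using this
  rw [show θ.predict M = fun x => inner ℝ θ.out (θ.feature M x L le_rfl) from
    funext (predict_eq_inner θ)]
  exact continuous_const.inner h

theorem abs_predict_sub_predict_le (hM : M ∈ Matrix.orthogonalGroup (Fin c) ℝ)
    (hBl : ∀ l, 0 < Bl l) {θ θ' : TNNWeights L c d} (hθ : ∀ l, ‖θ.layer l‖ ≤ Bl l)
    (hθ' : ∀ l, ‖θ'.layer l‖ ≤ Bl l) (hw' : ‖θ'.out‖ ≤ Bw) {ε : ℝ}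
    (hε : ∀ l, ‖θ.layer l - θ'.layer l‖ ≤ 2 * ε * Bl l) (hεw : ‖θ.out - θ'.out‖ ≤ ε * Bw)
    (x : TVec (d 0) c) :
    |θ.predict M x - θ'.predict M x| ≤ (2 * L + 1) * ε * (‖x‖ * (Bw * ∏ l, Bl l)) := by
  have h1 := norm_feature_le hM hBl hθ x L le_rfl
  have h2 := norm_feature_sub_feature_le_of_weights hM hBl hθ hθ' hε x L le_rfl
  simp only [Fin.castLE_rfl, id] at h1 h2
  rw [predict_eq_inner, predict_eq_inner]
  have e : inner ℝ θ.out (θ.feature M x L le_rfl) - inner ℝ θ'.out (θ'.feature M x L le_rfl) =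
      inner ℝ (θ.out - θ'.out) (θ.feature M x L le_rfl) +
        inner ℝ θ'.out (θ.feature M x L le_rfl - θ'.feature M x L le_rfl) := by
    rw [inner_sub_left, inner_sub_right]
    ring
  rw [e]
  calc _ ≤ ‖θ.out - θ'.out‖ * ‖θ.feature M x L le_rfl‖ +
          ‖θ'.out‖ * ‖θ.feature M x L le_rfl - θ'.feature M x L le_rfl‖ :=
        (abs_add_le _ _).trans (add_le_add (abs_real_inner_le_norm _ _)
          (abs_real_inner_le_norm _ _))
    _ ≤ ε * Bw * ((∏ l, Bl l) * ‖x‖) + Bw * (L * (2 * ε) * ((∏ l, Bl l) * ‖x‖)) :=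
        add_le_add (mul_le_mul hεw h1 (norm_nonneg _) ((norm_nonneg _).trans hεw))
          (mul_le_mul hw' h2 (norm_nonneg _) ((norm_nonneg _).trans hw'))
    _ = _ := by ring

end TNNWeights

/-! ### The adversarial loss -/

section AdvLoss

variable {d c : ℕ} {R : Seminorm ℝ (TVec d c)} {ξ : ℝ} {φ : ℝ → ℝ}

theorem Seminorm.continuous_of_finiteDimensional {E : Type*} [NormedAddCommGroup E]
    [NormedSpace ℝ E] [FiniteDimensional ℝ E] (R : Seminorm ℝ E) : Continuous R :=
  continuousOn_univ.1 (R.convexOn.continuousOn isOpen_univ)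

theorem bddAbove_norm_div (hR : ∀ x, R x = 0 → x = 0) :
    BddAbove ((fun x => ‖x‖ / R x) '' {x : TVec d c | x ≠ 0}) := by
  have hRpos : ∀ x, x ≠ 0 → 0 < R x := fun x hx =>
    lt_of_le_of_ne (apply_nonneg R x) fun h => hx (hR x h.symm)
  rcases (Metric.sphere (0 : TVec d c) 1).eq_empty_or_nonempty with hemp | hne
  · refine ⟨0, ?_⟩
    rintro _ ⟨x, hx, rfl⟩
    have : (‖x‖⁻¹ • x) ∈ Metric.sphere (0 : TVec d c) 1 := by
      simp [norm_smul, inv_mul_cancel₀ (norm_ne_zero_iff.2 hx)]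
    rw [hemp] at this
    exact absurd this (Set.notMem_empty _)
  · obtain ⟨y, hy, hmin⟩ := (isCompact_sphere (0 : TVec d c) 1).exists_isMinOn hne
      R.continuous_of_finiteDimensional.continuousOn
    have hy0 : 0 < R y := hRpos y (by
      rintro rfl
      simp at hy)
    refine ⟨1 / R y, ?_⟩
    rintro _ ⟨x, hx, rfl⟩
    have hx0 : 0 < ‖x‖ := norm_pos_iff.2 hx
    have h1 : R y ≤ R (‖x‖⁻¹ • x) := hmin (by
      simp [norm_smul, inv_mul_cancel₀ (norm_ne_zero_iff.2 hx)])
    rw [map_smul_eq_mul, norm_inv, norm_norm, le_inv_mul_iff₀ hx0] at h1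
    simp only
    rw [div_le_div_iff₀ (hRpos x hx) hy0]
    linarith

theorem norm_le_compatConst_mul (hR : ∀ x, R x = 0 → x = 0) (x : TVec d c) :
    ‖x‖ ≤ compatConst R * R x := by
  rcases eq_or_ne x 0 with rfl | hx
  · simp
  · have hRx : 0 < R x := lt_of_le_of_ne (apply_nonneg R x) fun h => hx (hR x h.symm)
    rw [← div_le_iff₀ hRx]
    exact le_csSup (bddAbove_norm_div hR) ⟨x, hx, rfl⟩

theorem compatConst_nonneg (R : Seminorm ℝ (TVec d c)) : 0 ≤ compatConst R := by
  refine Real.sSup_nonneg ?_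
  rintro _ ⟨x, -, rfl⟩
  exact div_nonneg (norm_nonneg _) (apply_nonneg R x)

theorem isCompact_attackSet (hR : ∀ x, R x = 0 → x = 0) (x : TVec d c) :
    IsCompact {x' | R (x' - x) ≤ ξ} := by
  refine Metric.isCompact_of_isClosed_isBounded ?_ ?_
  · exact isClosed_le (R.continuous_of_finiteDimensional.comp (continuous_id.sub continuous_const))
      continuous_const
  · refine (Metric.isBounded_closedBall (x := x) (r := compatConst R * ξ)).subset fun x' hx' => ?_
    rw [mem_closedBall_iff_norm]
    exact (norm_le_compatConst_mul hR _).trans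
      (mul_le_mul_of_nonneg_left hx' (compatConst_nonneg R))

theorem continuous_advLoss (hR : ∀ x, R x = 0 → x = 0) (hφ : Continuous φ)
    {f : TVec d c → ℝ} (hf : Continuous f) : Continuous (advLoss φ R ξ f) := by
  have hK : IsCompact {u : TVec d c | R u ≤ ξ} := by
    simpa using isCompact_attackSet (ξ := ξ) hR 0
  have h1 := hK.continuous_sSup (f := fun (z : TVec d c × ℝ) u => expLoss φ (f (z.1 + u)) z.2) (by
    change Continuous fun p : (TVec d c × ℝ) × TVec d c =>
      Real.exp (-φ (p.1.2 * f (p.1.1 + p.2)))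
    fun_prop)
  convert h1 using 2 with z
  rw [advLoss]
  congr 1
  ext q
  constructor
  · rintro ⟨x', hx', rfl⟩
    exact ⟨x' - z.1, hx', by simp⟩
  · rintro ⟨u, hu, rfl⟩
    exact ⟨z.1 + u, by simpa using hu, rfl⟩

theorem bddAbove_expLoss_image (hR : ∀ x, R x = 0 → x = 0) (hφ : Continuous φ)
    {f : TVec d c → ℝ} (hf : Continuous f) (z : TVec d c × ℝ) :
    BddAbove ((fun x' => expLoss φ (f x') z.2) '' {x' | R (x' - z.1) ≤ ξ}) := by
  refine (isCompact_attackSet hR z.1).bddAbove_image (Continuous.continuousOn ?_)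
  unfold expLoss
  fun_prop

theorem attackSet_nonempty (hξ : 0 ≤ ξ) (x : TVec d c) : {x' | R (x' - x) ≤ ξ}.Nonempty :=
  ⟨x, by simpa using hξ⟩

theorem advLoss_nonneg (f : TVec d c → ℝ) (z : TVec d c × ℝ) : 0 ≤ advLoss φ R ξ f z := by
  refine Real.sSup_nonneg ?_
  rintro _ ⟨x, -, rfl⟩
  exact (Real.exp_pos _).le

theorem advLoss_sub_le (hR : ∀ x, R x = 0 → x = 0) (hξ : 0 ≤ ξ) (hφ : Continuous φ)
    {f g : TVec d c → ℝ} (hg : Continuous g) (z : TVec d c × ℝ) {η : ℝ}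
    (h : ∀ x', R (x' - z.1) ≤ ξ → |expLoss φ (f x') z.2 - expLoss φ (g x') z.2| ≤ η) :
    advLoss φ R ξ f z - advLoss φ R ξ g z ≤ η := by
  rw [sub_le_iff_le_add]
  refine csSup_le ((attackSet_nonempty hξ z.1).image _) ?_
  rintro _ ⟨x', hx', rfl⟩
  have h1 := (abs_le.1 (h x' hx')).2
  have h2 : expLoss φ (g x') z.2 ≤ advLoss φ R ξ g z :=
    le_csSup (bddAbove_expLoss_image hR hφ hg z) ⟨x', hx', rfl⟩
  simp only
  linarith

theorem abs_advLoss_sub_le (hR : ∀ x, R x = 0 → x = 0) (hξ : 0 ≤ ξ) (hφ : Continuous φ)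
    {f g : TVec d c → ℝ} (hf : Continuous f) (hg : Continuous g) (z : TVec d c × ℝ) {η : ℝ}
    (h : ∀ x', R (x' - z.1) ≤ ξ → |expLoss φ (f x') z.2 - expLoss φ (g x') z.2| ≤ η) :
    |advLoss φ R ξ f z - advLoss φ R ξ g z| ≤ η := by
  have h1 := advLoss_sub_le hR hξ hφ hg z h
  have h2 := advLoss_sub_le hR hξ hφ hf z fun x' hx' => by
    rw [abs_sub_comm]
    exact h x' hx'
  rw [abs_le]
  constructor <;> linarith

theorem lossLip_nonneg (hφ : RegularExponent φ) (b : ℝ) : 0 ≤ lossLip φ b := by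
  refine Real.sSup_nonneg ?_
  rintro _ ⟨q, -, rfl⟩
  exact mul_nonneg (hφ.deriv_nonneg q) (Real.exp_pos _).le

theorem abs_expLoss_sub_le (hφ : RegularExponent φ) {b p q y : ℝ} (hp : |p| ≤ b) (hq : |q| ≤ b)
    (hy : y = 1 ∨ y = -1) :
    |expLoss φ p y - expLoss φ q y| ≤ lossLip φ b * |p - q| := by
  have hy1 : |y| = 1 := by rcases hy with rfl | rfl <;> simp
  have hdiff : Differentiable ℝ φ := hφ.contDiff.differentiable one_ne_zero
  have hcont : Continuous fun q => deriv φ q * Real.exp (-φ q) :=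
    (hφ.contDiff.continuous_deriv le_rfl).mul
      (Real.continuous_exp.comp hφ.contDiff.continuous.neg)
  have hderiv : ∀ x, HasDerivAt (fun q => Real.exp (-φ q)) (Real.exp (-φ x) * -deriv φ x) x :=
    fun x => (hdiff x).hasDerivAt.neg.exp
  have hbound : ∀ x ∈ Icc (-b) b, ‖Real.exp (-φ x) * -deriv φ x‖ ≤ lossLip φ b := by
    intro x hx
    have h1 : ‖Real.exp (-φ x) * -deriv φ x‖ = deriv φ x * Real.exp (-φ x) := by
      rw [norm_mul, norm_neg, Real.norm_of_nonneg (Real.exp_pos _).le,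
        Real.norm_of_nonneg (hφ.deriv_nonneg x), mul_comm]
    rw [h1]
    exact le_csSup (isCompact_Icc.bddAbove_image hcont.continuousOn) ⟨x, hx, rfl⟩
  have hmem : ∀ u, |u| ≤ b → y * u ∈ Icc (-b) b := fun u hu => by
    rw [mem_Icc, ← abs_le, abs_mul, hy1, one_mul]
    exact hu
  have h := (convex_Icc (-b) b).norm_image_sub_le_of_norm_hasDerivWithin_le
    (fun x _ => (hderiv x).hasDerivWithinAt) hbound (hmem q hq) (hmem p hp)
  rwa [← mul_sub, norm_mul, Real.norm_eq_abs, Real.norm_eq_abs, Real.norm_eq_abs, hy1,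
    one_mul] at h

end AdvLoss

/-! ### The generalization bound -/

theorem one_le_log_nine_mul (L : ℕ) : 1 ≤ Real.log (9 * ((L : ℝ) + 1)) := by
  rw [Real.le_log_iff_exp_le (by positivity)]
  have h1 := Real.exp_one_lt_d9
  have h2 : (0 : ℝ) ≤ L := L.cast_nonneg
  linarith

/-- The generalization bound for a class of t-NNs which is parametrized by the unit ball of a
normed space of dimension at most `2 * D`, with the weights depending on the parameter in a
Lipschitz way. -/
theorem measure_exists_lt_advRisk_sub_le {Θ : Type*} [NormedAddCommGroup Θ] [NormedSpace ℝ Θ]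
    [FiniteDimensional ℝ Θ] {L c N : ℕ} {d : ℕ → ℕ} {M : Matrix (Fin c) (Fin c) ℝ}
    {Bx Bw B D ξ t : ℝ} {Bl : Fin L → ℝ} {φ : ℝ → ℝ} {R : Seminorm ℝ (TVec (d 0) c)}
    {P : Measure (TVec (d 0) c × ℝ)} [IsProbabilityMeasure P] (hN : 1 ≤ N)
    (hM : M ∈ Matrix.orthogonalGroup (Fin c) ℝ) (hBx : 0 < Bx) (hBw : 0 < Bw)
    (hBl : ∀ l, 0 < Bl l) (hB : 0 < B) (hξ : 0 ≤ ξ) (hR : ∀ x, R x = 0 → x = 0)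
    (hP : ∀ᵐ z ∂P, ‖z.1‖ ≤ Bx ∧ (z.2 = 1 ∨ z.2 = -1)) (hφ : RegularExponent φ)
    (hloss : ∀ f ∈ tnnClass d M Bw Bl, ∀ x x' : TVec (d 0) c, ‖x‖ ≤ Bx → R (x' - x) ≤ ξ →
      ∀ y : ℝ, y = 1 ∨ y = -1 → expLoss φ (f x') y ≤ B) (ht : 0 < t)
    {w : Θ → TNNWeights L c d} (hwl : ∀ θ, ‖θ‖ ≤ 1 → ∀ l, ‖(w θ).layer l‖ ≤ Bl l)
    (hwo : ∀ θ, ‖θ‖ ≤ 1 → ‖(w θ).out‖ ≤ Bw)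
    (hwl' : ∀ θ θ', ‖θ‖ ≤ 1 → ‖θ'‖ ≤ 1 → ∀ l,
      ‖(w θ).layer l - (w θ').layer l‖ ≤ 2 * ‖θ - θ'‖ * Bl l)
    (hwo' : ∀ θ θ', ‖(w θ).out - (w θ').out‖ ≤ ‖θ - θ'‖ * Bw)
    (hdim : (Module.finrank ℝ Θ : ℝ) ≤ 2 * D) :
    (Measure.pi fun _ : Fin N => P)
      {S | ∃ θ, ‖θ‖ ≤ 1 ∧
        24 * (lossLip φ (outBound R ξ Bx Bw Bl) * outBound R ξ Bx Bw Bl) *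
            √(D * Real.log (9 * ((L : ℝ) + 1))) / √(N : ℝ) + 3 * B * √(t / (2 * (N : ℝ))) <
          advRisk φ R ξ P ((w θ).predict M) - empAdvRisk φ R ξ S ((w θ).predict M)} ≤
      ENNReal.ofReal (Real.exp (-t)) := by
  set b := outBound R ξ Bx Bw Bl with hb
  set Λ := Real.log (9 * ((L : ℝ) + 1))
  have hb0 : 0 ≤ b := by
    have := compatConst_nonneg R
    have := Finset.prod_pos fun l (_ : l ∈ Finset.univ) => hBl l
    rw [hb, outBound]
    positivity
  have hφc : Continuous φ := hφ.contDiff.continuous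
  -- the loss is cut off outside the almost sure range of the data
  let good : Set (TVec (d 0) c × ℝ) := {z | ‖z.1‖ ≤ Bx ∧ (z.2 = 1 ∨ z.2 = -1)}
  have hgood : MeasurableSet good := by
    have h1 : MeasurableSet {z : TVec (d 0) c × ℝ | ‖z.1‖ ≤ Bx} :=
      (isClosed_le (by fun_prop) continuous_const).measurableSet
    have h2 : MeasurableSet {z : TVec (d 0) c × ℝ | z.2 = 1} :=
      (isClosed_eq (by fun_prop) continuous_const).measurableSet
    have h3 : MeasurableSet {z : TVec (d 0) c × ℝ | z.2 = -1} :=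
      (isClosed_eq (by fun_prop) continuous_const).measurableSet
    exact h1.inter (h2.union h3)
  let h : Θ → TVec (d 0) c × ℝ → ℝ := fun θ =>
    good.indicator (advLoss φ R ξ ((w θ).predict M))
  have hcont : ∀ θ, Continuous ((w θ).predict M) := fun θ =>
    TNNWeights.continuous_predict hM (w θ)
  have hinput : ∀ z ∈ good, ∀ x', R (x' - z.1) ≤ ξ → ‖x'‖ * (Bw * ∏ l, Bl l) ≤ b := by
    intro z hz x' hx'
    have h1 : ‖x'‖ ≤ Bx + ξ * compatConst R := by
      calc ‖x'‖ = ‖z.1 + (x' - z.1)‖ := by rw [add_sub_cancel]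
        _ ≤ ‖z.1‖ + ‖x' - z.1‖ := norm_add_le _ _
        _ ≤ Bx + ξ * compatConst R := by
          refine add_le_add hz.1 ((norm_le_compatConst_mul hR _).trans ?_)
          rw [mul_comm]
          exact mul_le_mul_of_nonneg_right hx' (compatConst_nonneg R)
    exact mul_le_mul_of_nonneg_right h1
      (mul_nonneg hBw.le (Finset.prod_nonneg fun l _ => (hBl l).le))
  have hpred : ∀ θ, ‖θ‖ ≤ 1 → ∀ z ∈ good, ∀ x', R (x' - z.1) ≤ ξ →
      |(w θ).predict M x'| ≤ b := fun θ hθ z hz x' hx' =>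
    (TNNWeights.abs_predict_le hM hBl (hwl θ hθ) (hwo θ hθ) x').trans (hinput z hz x' hx')
  have hdist : ∀ θ θ', ‖θ‖ ≤ 1 → ‖θ'‖ ≤ 1 → ∀ u : ℝ, 0 ≤ u →
      (∀ z ∈ good, ∀ x', R (x' - z.1) ≤ ξ →
        |(w θ).predict M x' - (w θ').predict M x'| ≤ u) →
      ∀ z, |h θ z - h θ' z| ≤ lossLip φ b * u := by
    intro θ θ' hθ hθ' u hu hdiff z
    by_cases hz : z ∈ good
    · simp only [h, Set.indicator_of_mem hz]
      refine abs_advLoss_sub_le hR hξ hφc (hcont θ) (hcont θ') z fun x' hx' => ?_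
      exact (abs_expLoss_sub_le hφ (hpred θ hθ z hz x' hx') (hpred θ' hθ' z hz x' hx') hz.2).trans
        (mul_le_mul_of_nonneg_left (hdiff z hz x' hx') (lossLip_nonneg hφ b))
    · simp only [h, Set.indicator_of_notMem hz, sub_self, abs_zero]
      exact mul_nonneg (lossLip_nonneg hφ b) hu
  have hmain := measure_exists_lt_meanDeviation_le (P := P) (h := h) (A := 2 * L + 1) (B := B)
    (D := D) (G := lossLip φ b * b) (Λ := Λ) hN ht
    (by linarith [(Nat.cast_nonneg L : (0 : ℝ) ≤ L)]) hB
    (mul_nonneg (lossLip_nonneg hφ b) hb0) (one_le_log_nine_mul L)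
    (Real.log_le_log (by positivity) (by linarith [(Nat.cast_nonneg L : (0 : ℝ) ≤ L)])) hdim
    (fun θ _ => (continuous_advLoss hR hφc (hcont θ)).measurable.indicator hgood)
    (fun θ _ z => Set.indicator_nonneg (fun z _ => advLoss_nonneg _ z) z)
    (fun θ hθ z => by
      refine Set.indicator_le' (fun z hz => ?_) (fun _ _ => hB.le) z
      refine csSup_le ((attackSet_nonempty hξ z.1).image _) ?_
      rintro _ ⟨x', hx', rfl⟩
      exact hloss _ ⟨w θ, hwo θ hθ, hwl θ hθ, rfl⟩ z.1 x' hz.1 hx' z.2 hz.2)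
    (fun θ θ' hθ hθ' z => by
      refine (hdist θ θ' hθ hθ' (2 * b) (by positivity) (fun z hz x' hx' => ?_) z).trans
        (by linarith)
      have h1 := hpred θ hθ z hz x' hx'
      have h2 := hpred θ' hθ' z hz x' hx'
      exact (abs_sub _ _).trans (by linarith))
    (fun θ θ' hθ hθ' z => by
      refine (hdist θ θ' hθ hθ' ((2 * L + 1) * ‖θ - θ'‖ * b) (by positivity)
        (fun z hz x' hx' => ?_) z).trans (by linarith)
      refine (TNNWeights.abs_predict_sub_predict_le hM hBl (hwl θ hθ) (hwl θ' hθ') (hwo θ' hθ')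
        (hwl' θ θ' hθ hθ') (hwo' θ θ') x').trans ?_
      exact mul_le_mul_of_nonneg_left (hinput z hz x' hx') (by positivity))
  refine (measure_mono_ae ?_).trans hmain
  have hall : ∀ᵐ S ∂(Measure.pi fun _ : Fin N => P), ∀ i, S i ∈ good := by
    rw [ae_all_iff]
    intro i
    exact (measurePreserving_eval (fun _ : Fin N => P) i).quasiMeasurePreserving.ae hP
  filter_upwards [hall] with S hS
  rintro ⟨θ, hθ, hlt⟩
  refine ⟨θ, hθ, hlt.trans_eq ?_⟩
  have h1 : advRisk φ R ξ P ((w θ).predict M) = ∫ z, h θ z ∂P := by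
    refine integral_congr_ae ?_
    filter_upwards [hP] with z hz
    exact (Set.indicator_of_mem (s := good) hz _).symm
  have h2 : ∀ i, h θ (S i) = advLoss φ R ξ ((w θ).predict M) (S i) := fun i =>
    Set.indicator_of_mem (hS i) _
  simp only [meanDeviation, empAdvRisk, h1, h2]

/-- The parameters of a t-NN with layers of tubal rank at most `r l`. -/
abbrev LowRankParam (L c : ℕ) (d : ℕ → ℕ) (r : Fin L → ℕ) : Type :=
  (∀ l : Fin L, Tensor3.FactorParam (d (l + 1)) (d l) (r l) c) × TVec (d L) c

/-- The t-NN with the given factors; the unit ball of the parameters is mapped to weights obeying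
the norm bounds `Bl` and `Bw`. -/
noncomputable def LowRankParam.toWeights {L c : ℕ} {d : ℕ → ℕ} {r : Fin L → ℕ}
    (M : Matrix (Fin c) (Fin c) ℝ) (Bw : ℝ) (Bl : Fin L → ℝ) (θ : LowRankParam L c d r) :
    TNNWeights L c d where
  layer l := Bl l • Tensor3.ofFactors M (θ.1 l).1 (θ.1 l).2
  out := Bw • θ.2

theorem finrank_lowRankParam (L c : ℕ) (d : ℕ → ℕ) (r : Fin L → ℕ) :
    Module.finrank ℝ (LowRankParam L c d r) =
      ∑ l : Fin L, c * (r l * (d l + d (l + 1))) + d L * c := by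
  rw [Module.finrank_prod, Module.finrank_pi_fintype]
  simp only [Tensor3.finrank_factorParam]
  simp

/-- A t-NN whose last layer has tubal rank zero vanishes. -/
theorem predict_eq_zero_of_tubalRank_eq_zero {k c : ℕ} {d : ℕ → ℕ}
    {M : Matrix (Fin c) (Fin c) ℝ} (hM : M ∈ Matrix.orthogonalGroup (Fin c) ℝ)
    {θ : TNNWeights (k + 1) c d} (hθ : Tensor3.tubalRank M (θ.layer (Fin.last k)) ≤ (0 : ℕ)) :
    θ.predict M = 0 := by
  obtain ⟨p, -, hp⟩ := Tensor3.exists_ofFactors_eq hM hθ (b := ‖θ.layer (Fin.last k)‖ + 1)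
    (by positivity) (lt_add_one _).le
  have h0 : Tensor3.ofFactors M p.1 p.2 = 0 := by
    have h1 := Tensor3.norm_ofFactors_le hM p.1 p.2
    have h2 : ‖p.2‖ = 0 := norm_eq_zero.2 (by
      ext x i
      exact i.elim0)
    rw [h2, mul_zero] at h1
    exact norm_le_zero_iff.1 h1
  rw [h0, smul_zero] at hp
  funext x
  have h1 : θ.feature M x (k + 1) le_rfl = 0 := by
    rw [← norm_le_zero_iff]
    refine (Tensor3.norm_relu_le _).trans ((Tensor3.norm_tProd_le hM _ _).trans ?_)
    have : θ.layer ⟨k, Nat.lt_succ_self k⟩ = 0 := hp.symm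
    rw [this, norm_zero, zero_mul]
  rw [TNNWeights.predict_eq_inner, h1, inner_zero_right]
  rfl

theorem mainTheorem3 :
    ∃ C' : ℝ, 0 < C' ∧
      ∀ (L c N : ℕ) (d : ℕ → ℕ) (M : Matrix (Fin c) (Fin c) ℝ) (r : Fin L → ℕ)
        (Bx Bw B ξ : ℝ) (Bl : Fin L → ℝ) (φ : ℝ → ℝ) (R : Seminorm ℝ (TVec (d 0) c))
        (P : Measure (TVec (d 0) c × ℝ)),
        1 ≤ L → 1 ≤ N →
        M ∈ Matrix.orthogonalGroup (Fin c) ℝ →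
        (∀ l : Fin L, r l ≤ min (d (l + 1)) (d l)) →
        0 < Bx → 0 < Bw → (∀ l, 0 < Bl l) → 0 < B → 0 ≤ ξ →
        -- the attack is measured in a norm
        (∀ x, R x = 0 → x = 0) →
        -- the data: inputs bounded by `Bx`, labels `±1`
        IsProbabilityMeasure P →
        (∀ᵐ z ∂P, ‖z.1‖ ≤ Bx ∧ (z.2 = 1 ∨ z.2 = -1)) →
        -- the loss, with values in `[0, B]` on the outputs of the class under attack
        RegularExponent φ →
        (∀ f ∈ tnnClass d M Bw Bl, ∀ x x' : TVec (d 0) c, ‖x‖ ≤ Bx → R (x' - x) ≤ ξ →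
          ∀ y : ℝ, y = 1 ∨ y = -1 → expLoss φ (f x') y ≤ B) →
        ∀ t : ℝ, 0 < t →
          -- outside an event of probability at most `2 * exp (-t)`, the bound holds
          -- simultaneously for all networks in the class
          (Measure.pi fun _ : Fin N => P)
            {S | ¬ ∀ f ∈ lowRankClass d M Bw Bl r,
              advRisk φ R ξ P f - empAdvRisk φ R ξ S f ≤
                C' * lossLip φ (outBound R ξ Bx Bw Bl) * outBound R ξ Bx Bw Bl / √(N : ℝ) *
                    √((c : ℝ) * ∑ l : Fin L, (r l : ℝ) * ((d l : ℝ) + (d (l + 1) : ℝ)) *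
                      Real.log (9 * ((L : ℝ) + 1)))
                  + 3 * B * √(t / (2 * (N : ℝ)))}
            ≤ ENNReal.ofReal (2 * Real.exp (-t)) := by
  refine ⟨24, by norm_num, ?_⟩
  intro L c N d M r Bx Bw B ξ Bl φ R P hL hN hM _ hBx hBw hBl hB hξ hR hPprob hP hφ hloss t ht
  set D : ℝ := c * ∑ l : Fin L, (r l : ℝ) * ((d l : ℝ) + (d (l + 1) : ℝ)) with hD
  have hD0 : 0 ≤ D := by positivity
  have hDlog : (c : ℝ) * ∑ l : Fin L, (r l : ℝ) * ((d l : ℝ) + (d (l + 1) : ℝ)) *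
      Real.log (9 * ((L : ℝ) + 1)) = D * Real.log (9 * ((L : ℝ) + 1)) := by
    rw [← Finset.sum_mul, ← mul_assoc]
  rw [hDlog]
  set b := outBound R ξ Bx Bw Bl
  have hexp : ENNReal.ofReal (Real.exp (-t)) ≤ ENNReal.ofReal (2 * Real.exp (-t)) :=
    ENNReal.ofReal_le_ofReal (by linarith [Real.exp_pos (-t)])
  have hform : 24 * (lossLip φ b * b) * √(D * Real.log (9 * ((L : ℝ) + 1))) / √(N : ℝ) =
      24 * lossLip φ b * b / √(N : ℝ) * √(D * Real.log (9 * ((L : ℝ) + 1))) := by ring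
  obtain ⟨k, rfl⟩ : ∃ k, L = k + 1 := ⟨L - 1, by omega⟩
  rcases Nat.eq_zero_or_pos (r (Fin.last k)) with hr | hr
  · -- every network of the class vanishes, and a single parameter covers the class
    have hmain := measure_exists_lt_advRisk_sub_le (Θ := EuclideanSpace ℝ (Fin 0)) (D := D)
      (w := fun _ => (⟨fun _ => 0, 0⟩ : TNNWeights (k + 1) c d))
      hN hM hBx hBw hBl hB hξ hR hP hφ hloss ht
      (fun _ _ l => by simpa using (hBl l).le) (fun _ _ => by simpa using hBw.le)
      (fun _ _ _ _ l => by
        have := (hBl l).le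
        simp only [sub_self, norm_zero]
        positivity)
      (fun _ _ => by
        simp only [sub_self, norm_zero]
        positivity)
      (by simpa using hD0)
    refine (measure_mono ?_).trans (hmain.trans hexp)
    intro S hS
    simp only [mem_ofPred_eq, not_forall, not_le] at hS
    obtain ⟨_, ⟨θ, -, -, hrank, rfl⟩, hlt⟩ := hS
    refine ⟨0, by simp, ?_⟩
    have h1 : θ.predict M = 0 :=
      predict_eq_zero_of_tubalRank_eq_zero hM ((hrank (Fin.last k)).trans_eq (by rw [hr]))
    have h2 : (⟨fun _ => 0, 0⟩ : TNNWeights (k + 1) c d).predict M = 0 := by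
      funext x
      rw [TNNWeights.predict_eq_inner, inner_zero_left]
      rfl
    rw [h1] at hlt
    rw [h2, hform]
    exact hlt
  · have hdim : (Module.finrank ℝ (LowRankParam (k + 1) c d r) : ℝ) ≤ 2 * D := by
      have h1 : (Module.finrank ℝ (LowRankParam (k + 1) c d r) : ℝ) = D + d (k + 1) * c := by
        rw [finrank_lowRankParam, hD, Finset.mul_sum]
        push_cast
        rfl
      have h2 : (d (k + 1) : ℝ) ≤
          ∑ l : Fin (k + 1), (r l : ℝ) * ((d l : ℝ) + (d (l + 1) : ℝ)) := by
        refine le_trans ?_ (Finset.single_le_sum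
          (f := fun l : Fin (k + 1) => (r l : ℝ) * ((d l : ℝ) + (d (l + 1) : ℝ)))
          (fun l _ => by positivity) (Finset.mem_univ (Fin.last k)))
        have h3 : (1 : ℝ) ≤ r (Fin.last k) := by exact_mod_cast hr
        have h4 : (0 : ℝ) ≤ d k := Nat.cast_nonneg _
        have h5 : (0 : ℝ) ≤ d (k + 1) := Nat.cast_nonneg _
        simp only [Fin.val_last]
        nlinarith
      have h3 : (d (k + 1) : ℝ) * c ≤ D := by
        rw [hD, mul_comm]
        exact mul_le_mul_of_nonneg_left h2 (Nat.cast_nonneg c)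
      linarith
    have hcomp : ∀ (θ : LowRankParam (k + 1) c d r), ‖θ‖ ≤ 1 → ∀ l, ‖θ.1 l‖ ≤ 1 :=
      fun θ hθ l => (norm_le_pi_norm θ.1 l).trans ((norm_fst_le θ).trans hθ)
    have hmain := measure_exists_lt_advRisk_sub_le (Θ := LowRankParam (k + 1) c d r) (D := D)
      (w := LowRankParam.toWeights M Bw Bl) hN hM hBx hBw hBl hB hξ hR hP hφ hloss ht
      (fun θ hθ l => by
        have h1 := Tensor3.norm_ofFactors_le hM (θ.1 l).1 (θ.1 l).2
        have h2 : ‖(θ.1 l).1‖ * ‖(θ.1 l).2‖ ≤ 1 :=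
          mul_le_one₀ ((norm_fst_le (θ.1 l)).trans (hcomp θ hθ l)) (norm_nonneg _)
            ((norm_snd_le (θ.1 l)).trans (hcomp θ hθ l))
        simp only [LowRankParam.toWeights]
        rw [norm_smul, Real.norm_of_nonneg (hBl l).le]
        exact mul_le_of_le_one_right (hBl l).le (h1.trans h2))
      (fun θ hθ => by
        simp only [LowRankParam.toWeights]
        rw [norm_smul, Real.norm_of_nonneg hBw.le]
        exact mul_le_of_le_one_right hBw.le ((norm_snd_le θ).trans hθ))
      (fun θ θ' hθ hθ' l => by
        have h1 := Tensor3.norm_ofFactors_sub_le hM (hcomp θ hθ l) (hcomp θ' hθ' l)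
        have h2 : ‖θ.1 l - θ'.1 l‖ ≤ ‖θ - θ'‖ :=
          (norm_le_pi_norm (θ.1 - θ'.1) l).trans (norm_fst_le (θ - θ'))
        simp only [LowRankParam.toWeights]
        rw [← smul_sub, norm_smul, Real.norm_of_nonneg (hBl l).le, mul_comm]
        exact mul_le_mul_of_nonneg_right (h1.trans (by linarith)) (hBl l).le)
      (fun θ θ' => by
        simp only [LowRankParam.toWeights]
        rw [← smul_sub, norm_smul, Real.norm_of_nonneg hBw.le, mul_comm]
        exact mul_le_mul_of_nonneg_right (norm_snd_le (θ - θ')) hBw.le)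
      hdim
    refine (measure_mono ?_).trans (hmain.trans hexp)
    intro S hS
    simp only [mem_ofPred_eq, not_forall, not_le] at hS
    obtain ⟨_, ⟨θ, hout, hlayer, hrank, rfl⟩, hlt⟩ := hS
    choose p hp hpθ using fun l =>
      Tensor3.exists_ofFactors_eq hM (hrank l) (hBl l) (hlayer l)
    have hθ : LowRankParam.toWeights M Bw Bl (p, Bw⁻¹ • θ.out) = θ := by
      simp only [LowRankParam.toWeights, hpθ, smul_inv_smul₀ hBw.ne']
    refine ⟨(p, Bw⁻¹ • θ.out), ?_, ?_⟩
    · rw [Prod.norm_def, max_le_iff]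
      refine ⟨(pi_norm_le_iff_of_nonneg zero_le_one).2 hp, ?_⟩
      rw [norm_smul, norm_inv, Real.norm_of_nonneg hBw.le, inv_mul_le_iff₀ hBw, mul_one]
      exact hout
    · rw [hθ, hform]
      exact hlt
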